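/- For an open set $\Omega\subset\mathbb R$ let $\mathscr A(\Omega)$ be the space of complex-valued real analytic functions on $\Omega$ with its usual topology $\mathscr A(\Omega)=\operatorname{proj}_{K}\mathcal H(K)$, where $K$ runs through the compact subsets of $\Omega$ and $\mathcal H(K)=\operatorname{ind}_{U}\mathcal H(U)$ is the space of germs on $K$ of holomorphic functions, with the locally convex inductive limit topology over the open sets $U\subset\mathbb C$ containing $K$; here $\mathcal H(U)$ is the space of holomorphic functions on $U$ with the topology of uniform convergence on compact sets. A continuous linear operator $T$ on a topological vector space $X$ is called hypercyclic if the orbit $\{x,Tx,T^2x,\dots\}$ of some $x\in X$ is dense in $X$, and sequentially hypercyclic if there is $x\in X$ such that for each $y\in X$ there is a strictly increasing sequence $(n_k)_k$ of non-negative integers with $\lim_k T^{n_k}x=y$. Let $\varphi(x)=x^2$ on $]0,1[$. Then: (a) The composition operator $C_\varphi:\mathscr A(]0,1[)\to\mathscr A(]0,1[)$, $f\mapsto f\circ\varphi$, is sequentially hypercyclic. (b) There is no open set $U\subset\mathbb C$ containing $]0,1[$ such that $\varphi$ extends to a holomorphic map $\psi:U\to U$ for which the composition operator $C_\psi:\mathcal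 H(U)\to\mathcal H(U)$, $f\mapsto f\circ\psi$, is hypercyclic. Thus the first question of Bonet and Domański (is $C_\varphi$ (sequentially) hypercyclic on $\mathscr A(]0,1[)$?) has a positive answer, and the second one (does every sequentially hypercyclic $C_\varphi$ on $\mathscr A(\Omega)$ come from a hypercyclic $C_\varphi$ on some $\mathcal H(U)$ with $U$ a complex neighbourhood of $\Omega$ and $\varphi(U)\subset U$?) a negative one. -/

import Mathlib

open Filter Topology Set

noncomputable section

namespace RealAnalyticDynamics

/-! ## Sequential hypercyclicity and hypercyclicity -/

/-- `T` is sequentially hypercyclic: there is a vector `x` such that every `y` is the limit of a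
subsequence of the orbit `x, T x, T² x, …`. -/
def SequentiallyHypercyclic {X : Type*} [AddCommGroup X] [Module ℂ X] [TopologicalSpace X]
    [IsTopologicalAddGroup X] [ContinuousSMul ℂ X] (T : X →L[ℂ] X) : Prop :=
  ∃ x : X, ∀ y : X, ∃ n : ℕ → ℕ, StrictMono n ∧
    Tendsto (fun k => (T ^ n k) x) atTop (𝓝 y)

/-- `T` is hypercyclic: some orbit `{x, T x, T² x, …}` is dense. -/
def Hypercyclic {X : Type*} [AddCommGroup X] [Module ℂ X] [TopologicalSpace X]
    [IsTopologicalAddGroup X] [ContinuousSMul ℂ X] (T : X →L[ℂ] X) : Prop :=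
  ∃ x : X, Dense (range fun n : ℕ => (T ^ n) x)

/-! ## The space `ℋ(U)` of holomorphic functions on an open set -/

/-- Extension by zero of a function that is defined on a subset. -/
def zeroExt {α β : Type*} [Zero β] {p : α → Prop} (f : Subtype p → β) : α → β :=
  Function.extend Subtype.val f 0

theorem zeroExt_apply {α β : Type*} [Zero β] {p : α → Prop} (f : Subtype p → β) (x : α)
    (hx : p x) : zeroExt f x = f ⟨x, hx⟩ :=
  Subtype.val_injective.extend_apply f 0 ⟨x, hx⟩

/-- The space `ℋ(U)` of holomorphic functions on the open set `U`. As a subspace of `C(U, ℂ)` with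
the compact-open topology it carries the topology of uniform convergence on the compact subsets
of `U`. -/
def Hol (U : TopologicalSpace.Opens ℂ) : Submodule ℂ C(U, ℂ) where
  carrier := {f | DifferentiableOn ℂ (zeroExt f) U}
  add_mem' {f g} hf hg := (DifferentiableOn.add hf hg).congr fun z hz => by
    simp only [Pi.add_apply, zeroExt_apply _ z hz, ContinuousMap.add_apply]
  zero_mem' := (differentiableOn_const (0 : ℂ)).congr fun z hz => zeroExt_apply _ z hz
  smul_mem' c f hf := (DifferentiableOn.const_smul hf c).congr fun z hz => by
    simp only [Pi.smul_apply, zeroExt_apply _ z hz, ContinuousMap.smul_apply]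

theorem continuous_of_holomorphic {U V : TopologicalSpace.Opens ℂ} {ψ : V → U}
    (hψ : DifferentiableOn ℂ (zeroExt fun z => (ψ z : ℂ)) V) : Continuous ψ := by
  refine continuous_induced_rng.2 ((hψ.continuousOn.comp_continuous continuous_subtype_val
    fun z => z.2).congr fun z => ?_)
  exact zeroExt_apply _ _ z.2

/-- Composition with a holomorphic map `ψ : V → U`, as a continuous linear map
`ℋ(U) → ℋ(V)`, `f ↦ f ∘ ψ`. -/
def holComp {U V : TopologicalSpace.Opens ℂ} (ψ : V → U)
    (hψ : DifferentiableOn ℂ (zeroExt fun z => (ψ z : ℂ)) V) : Hol U →L[ℂ] Hol V where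
  toFun f := ⟨f.1.comp ⟨ψ, continuous_of_holomorphic hψ⟩, by
    refine (DifferentiableOn.comp f.2 hψ fun z hz => ?_).congr fun z hz => ?_
    · rw [zeroExt_apply _ z hz]; exact (ψ ⟨z, hz⟩).2
    · rw [Function.comp_apply, zeroExt_apply _ z hz, zeroExt_apply (fun z => (ψ z : ℂ)) z hz,
        zeroExt_apply _ _ (ψ ⟨z, hz⟩).2]; rfl⟩
  map_add' f g := rfl
  map_smul' c f := rfl
  cont := continuous_induced_rng.2
    ((ContinuousMap.continuous_precomp ⟨ψ, continuous_of_holomorphic hψ⟩).comp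
      continuous_subtype_val)

/-! ## The space `ℋ(K)` of holomorphic germs on a set -/

/-- The germs on `K` of functions that are holomorphic in a neighbourhood of `K`. -/
def holGermSubmodule (K : Set ℂ) : Submodule ℂ (Germ (𝓝ˢ K) ℂ) where
  carrier := {g | ∃ F : ℂ → ℂ, AnalyticOnNhd ℂ F K ∧ (F : Germ (𝓝ˢ K) ℂ) = g}
  add_mem' := by
    rintro _ _ ⟨F, hF, rfl⟩ ⟨G, hG, rfl⟩
    exact ⟨F + G, hF.add hG, rfl⟩
  zero_mem' := ⟨0, fun _ _ => analyticAt_const, rfl⟩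
  smul_mem' := by
    rintro c _ ⟨F, hF, rfl⟩
    exact ⟨c • F, fun z hz => (hF z hz).const_smul, rfl⟩

/-- The space `ℋ(K)` of holomorphic germs on `K`. -/
def HolGerm (K : Set ℂ) : Type := holGermSubmodule K

namespace HolGerm

instance (K : Set ℂ) : AddCommGroup (HolGerm K) := inferInstanceAs (AddCommGroup (holGermSubmodule K))

instance (K : Set ℂ) : Module ℂ (HolGerm K) := inferInstanceAs (Module ℂ (holGermSubmodule K))

/-- The germ on `K` of a function that is holomorphic near `K`. -/
def mk {K : Set ℂ} (F : ℂ → ℂ) (hF : AnalyticOnNhd ℂ F K) : HolGerm K := ⟨(F : Germ (𝓝ˢ K) ℂ), F, hF, rfl⟩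

theorem mk_eq_mk {K : Set ℂ} {F G : ℂ → ℂ} {hF : AnalyticOnNhd ℂ F K} {hG : AnalyticOnNhd ℂ G K} :
    mk F hF = mk G hG ↔ F =ᶠ[𝓝ˢ K] G :=
  Subtype.ext_iff.trans Germ.coe_eq

theorem exists_rep {K : Set ℂ} (g : HolGerm K) : ∃ F hF, g = mk F hF := by
  obtain ⟨g, F, hF, rfl⟩ := g
  exact ⟨F, hF, rfl⟩

/-- The linear map `ℋ(U) → ℋ(K)`, for an open set `U ⊇ K`, that takes a function to its germ
on `K`. -/
def ofHol (K : Set ℂ) (U : TopologicalSpace.Opens ℂ) (h : K ⊆ U) : Hol U →ₗ[ℂ] HolGerm K where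
  toFun f := mk (zeroExt f.1) ((DifferentiableOn.analyticOnNhd f.2 U.isOpen).mono h)
  map_add' f g := mk_eq_mk (hG := ((DifferentiableOn.analyticOnNhd f.2 U.isOpen).mono h).add
      ((DifferentiableOn.analyticOnNhd g.2 U.isOpen).mono h)) |>.2 <| EqOn.eventuallyEq_of_mem (s := (U : Set ℂ)) (fun z hz => by
      rw [zeroExt_apply _ z hz]
      refine Eq.trans ?_
        (congrArg₂ (· + ·) (zeroExt_apply f.1 z hz) (zeroExt_apply g.1 z hz)).symm
      rfl)
    (U.isOpen.mem_nhdsSet.2 h)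
  map_smul' c f := mk_eq_mk (F := zeroExt (c • f).1) (G := c • zeroExt f.1) (hG := fun z hz =>
      ((DifferentiableOn.analyticOnNhd f.2 U.isOpen).mono h z hz).const_smul) |>.2 <| EqOn.eventuallyEq_of_mem (s := (U : Set ℂ)) (fun z hz => by
      rw [zeroExt_apply _ z hz]
      refine Eq.trans ?_ (congrArg (c • ·) (zeroExt_apply f.1 z hz)).symm
      rfl)
    (U.isOpen.mem_nhdsSet.2 h)

/-- A topology on `ℋ(K)` that makes it a locally convex space for which all the maps
`ℋ(U) → ℋ(K)`, `U ⊇ K` open, are continuous. -/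
structure IsAdmissible (K : Set ℂ) (t : TopologicalSpace (HolGerm K)) : Prop where
  isTopologicalAddGroup : @IsTopologicalAddGroup (HolGerm K) t _
  continuousSMul : @ContinuousSMul ℂ (HolGerm K) _ _ t
  locallyConvexSpace : @LocallyConvexSpace ℝ (HolGerm K) _ _ _ _ t
  continuous_ofHol : ∀ (U : TopologicalSpace.Opens ℂ) (h : K ⊆ U),
    @Continuous (Hol U) (HolGerm K) _ t (ofHol K U h)

/-- `ℋ(K)` carries the topology of the locally convex inductive limit of the spaces `ℋ(U)`,
`U ⊇ K` open: the finest locally convex topology for which all the maps `ℋ(U) → ℋ(K)` are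
continuous. -/
instance (K : Set ℂ) : TopologicalSpace (HolGerm K) := sInf {t | IsAdmissible K t}

theorem isAdmissible (K : Set ℂ) :
    IsAdmissible K (inferInstance : TopologicalSpace (HolGerm K)) where
  isTopologicalAddGroup := topologicalAddGroup_sInf fun _ h => h.1
  continuousSMul := continuousSMul_sInf fun _ h => h.2
  locallyConvexSpace := LocallyConvexSpace.sInf fun _ h => h.3
  continuous_ofHol U h := continuous_sInf_rng.2 fun _ ht => ht.4 U h

instance (K : Set ℂ) : IsTopologicalAddGroup (HolGerm K) := (isAdmissible K).1

instance (K : Set ℂ) : ContinuousSMul ℂ (HolGerm K) := (isAdmissible K).2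

instance (K : Set ℂ) : LocallyConvexSpace ℝ (HolGerm K) := (isAdmissible K).3

/-- The universal property of the inductive limit. -/
theorem continuous_of_comp {K : Set ℂ} {E : Type*} [AddCommGroup E] [Module ℂ E]
    [TopologicalSpace E] [IsTopologicalAddGroup E] [ContinuousSMul ℂ E] [LocallyConvexSpace ℝ E]
    (L : HolGerm K →ₗ[ℂ] E)
    (h : ∀ (U : TopologicalSpace.Opens ℂ) (hU : K ⊆ U), Continuous (L ∘ ofHol K U hU)) :
    Continuous L := by
  rw [continuous_iff_le_induced]
  refine sInf_le ⟨topologicalAddGroup_induced L, continuousSMul_induced L,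
    LocallyConvexSpace.induced (L.restrictScalars ℝ), fun U hU => continuous_induced_rng.2 (h U hU)⟩

/-- Composition of a germ on `L` with a map `Φ` that is holomorphic near `K` and maps `K`
to `L`. -/
def comp {K L : Set ℂ} (Φ : ℂ → ℂ) (hΦ : AnalyticOnNhd ℂ Φ K) (hKL : MapsTo Φ K L) :
    HolGerm L →ₗ[ℂ] HolGerm K where
  toFun g := ⟨g.1.compTendsto Φ (by
      rw [Filter.Tendsto]
      intro s hs
      exact mem_nhdsSet_iff_forall.2 fun z hz =>
        (hΦ z hz).continuousAt (mem_nhdsSet_iff_forall.1 hs _ (hKL hz))), by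
    obtain ⟨g, F, hF, rfl⟩ := g
    exact ⟨F ∘ Φ, fun z hz => (hF _ (hKL hz)).comp (hΦ z hz), rfl⟩⟩
  map_add' := by
    rintro ⟨_, F, hF, rfl⟩ ⟨_, G, hG, rfl⟩; rfl
  map_smul' := by
    rintro c ⟨_, F, hF, rfl⟩; rfl

theorem comp_mk {K L : Set ℂ} (Φ : ℂ → ℂ) (hΦ : AnalyticOnNhd ℂ Φ K) (hKL : MapsTo Φ K L)
    (F : ℂ → ℂ) (hF : AnalyticOnNhd ℂ F L) :
    comp Φ hΦ hKL (mk F hF) = mk (F ∘ Φ) fun z hz => (hF _ (hKL hz)).comp (hΦ z hz) := rfl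

theorem continuous_comp {K L : Set ℂ} (Φ : ℂ → ℂ) (hΦ : AnalyticOnNhd ℂ Φ K)
    (hKL : MapsTo Φ K L) : Continuous (comp Φ hΦ hKL) := by
  refine continuous_of_comp _ fun U hU => ?_
  let V : TopologicalSpace.Opens ℂ :=
    ⟨interior ({z | AnalyticAt ℂ Φ z} ∩ Φ ⁻¹' U), isOpen_interior⟩
  have hV : ∀ z ∈ V, AnalyticAt ℂ Φ z ∧ Φ z ∈ U := fun z hz =>
    interior_subset (s := {z | AnalyticAt ℂ Φ z} ∩ Φ ⁻¹' U) hz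
  have hKV : K ⊆ V := fun z hz => mem_interior_iff_mem_nhds.2 <| inter_mem
    (hΦ z hz).eventually_analyticAt
    ((hΦ z hz).continuousAt (U.isOpen.mem_nhds (hU (hKL hz))))
  have hd : DifferentiableOn ℂ
      (zeroExt fun z : V => ((⟨Φ z, (hV z z.2).2⟩ : U) : ℂ)) V :=
    DifferentiableOn.congr (f := Φ)
      (fun z hz => (hV z hz).1.differentiableAt.differentiableWithinAt)
      (fun z hz => zeroExt_apply _ z hz)
  have key : ∀ f, comp Φ hΦ hKL (ofHol L U hU f) = ofHol K V hKV (holComp _ hd f) := by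
    intro f
    change comp Φ hΦ hKL (mk (zeroExt f.1)
      ((DifferentiableOn.analyticOnNhd f.2 U.isOpen).mono hU)) = mk (zeroExt (holComp _ hd f).1)
      ((DifferentiableOn.analyticOnNhd (holComp _ hd f).2 V.isOpen).mono hKV)
    rw [comp_mk]
    refine mk_eq_mk.2 (EqOn.eventuallyEq_of_mem (s := (V : Set ℂ)) (fun z hz => ?_)
      (V.isOpen.mem_nhdsSet.2 hKV))
    rw [Function.comp_apply, zeroExt_apply _ _ (hV z hz).2, zeroExt_apply _ z hz]
    rfl
  exact (((isAdmissible K).4 V hKV).comp (holComp _ hd).continuous).congr fun f => (key f).symm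

end HolGerm

/-! ## Holomorphic extension of real analytic functions -/

/-- The holomorphic extension of a real analytic function `f`, given by the Taylor series of `f`
at the real part of the variable. It is only used where `f` is analytic; see
`analyticAt_complexify` and `complexify_ofReal`. -/
def complexify (f : ℝ → ℂ) (z : ℂ) : ℂ :=
  ∑' n : ℕ, (n.factorial : ℂ)⁻¹ * iteratedDeriv n f z.re * (z.im * Complex.I) ^ n

theorem complexify_ofReal (f : ℝ → ℂ) (x : ℝ) : complexify f x = f x := by
  rw [complexify, tsum_eq_single 0]
  · simp
  · intro n hn
    simp [hn]

theorem exists_local_extension {f : ℝ → ℂ} {x : ℝ} (hf : AnalyticAt ℝ f x) :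
    ∃ F : ℂ → ℂ, AnalyticAt ℂ F x ∧ ∀ᶠ y : ℝ in 𝓝 x, F y = f y := by
  obtain ⟨p, hp⟩ := hf
  have hs := hasFPowerSeriesAt_iff'.1 hp
  let q : FormalMultilinearSeries ℂ ℂ ℂ := FormalMultilinearSeries.ofScalars ℂ p.coeff
  have hq : ∀ n, q.coeff n = p.coeff n := fun n => by
    simp [q, FormalMultilinearSeries.coeff_ofScalars]
  have hr : 0 < q.radius := by
    obtain ⟨r, hr, h⟩ := Metric.eventually_nhds_iff.1 hs
    have h1 := (h (y := x + r / 2) (by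
      rw [Real.dist_eq, add_sub_cancel_left, abs_of_pos] <;> linarith)).summable
    have h2 : (0 : ENNReal) < ((r / 2).toNNReal : ENNReal) := by simpa using hr
    refine h2.trans_le (q.le_radius_of_tendsto (l := 0) ?_)
    refine h1.tendsto_atTop_zero.norm.congr' (Eventually.of_forall fun n => ?_) |>.trans (by simp)
    rw [norm_smul, norm_pow, add_sub_cancel_left, Real.norm_eq_abs, abs_of_pos (half_pos hr),
      Real.coe_toNNReal _ (half_pos hr).le, mul_comm, FormalMultilinearSeries.norm_apply_eq_norm_coef,
      hq]
  have hF := (q.hasFPowerSeriesOnBall hr).comp_sub (x : ℂ)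
  rw [zero_add] at hF
  refine ⟨_, hF.analyticAt, ?_⟩
  have h2 := hasFPowerSeriesAt_iff'.1 hF.hasFPowerSeriesAt
  filter_upwards [hs, Complex.continuous_ofReal.continuousAt.eventually h2] with y h3 h4
  refine h4.unique ?_
  convert h3 using 2 with n
  rw [hq, ← Complex.ofReal_sub, ← Complex.ofReal_pow, Complex.coe_smul]

/-- The identity theorem: holomorphic extensions are unique. -/
theorem extension_unique {F G : ℂ → ℂ} {x : ℝ} (hF : AnalyticAt ℂ F x) (hG : AnalyticAt ℂ G x)
    (h : ∀ᶠ y : ℝ in 𝓝 x, F y = G y) : F =ᶠ[𝓝 (x : ℂ)] G := by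
  refine (hF.frequently_eq_iff_eventually_eq hG).1 ?_
  have ht : Tendsto (fun y : ℝ => (y : ℂ)) (𝓝[≠] x) (𝓝[≠] (x : ℂ)) :=
    tendsto_nhdsWithin_iff.2 ⟨Complex.continuous_ofReal.continuousAt.mono_left nhdsWithin_le_nhds,
      eventually_nhdsWithin_of_forall fun y hy => by simpa using hy⟩
  exact ht.frequently (h.filter_mono nhdsWithin_le_nhds).frequently

theorem iteratedDeriv_ofReal {F : ℂ → ℂ} {f : ℝ → ℂ} (n : ℕ) {x : ℝ} (hF : AnalyticAt ℂ F x)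
    (h : ∀ᶠ y : ℝ in 𝓝 x, F y = f y) : iteratedDeriv n F x = iteratedDeriv n f x := by
  induction n generalizing F f with
  | zero => simpa using h.self_of_nhds
  | succ n ih =>
    rw [iteratedDeriv_succ', iteratedDeriv_succ']
    refine ih hF.deriv ?_
    filter_upwards [h.eventually_nhds,
      Complex.continuous_ofReal.continuousAt.eventually hF.eventually_analyticAt] with y h1 h2
    exact (h2.differentiableAt.hasDerivAt.comp_ofReal.congr_of_eventuallyEq
      (h1.mono fun _ h => h.symm)).deriv.symm

theorem analyticAt_complexify {f : ℝ → ℂ} {x : ℝ} (hf : AnalyticAt ℝ f x) :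
    AnalyticAt ℂ (complexify f) x := by
  obtain ⟨F, hF, h⟩ := exists_local_extension hf
  refine hF.congr ?_
  obtain ⟨r, hr, hr1⟩ := Metric.eventually_nhds_iff_ball.1
    (hF.eventually_analyticAt.and hF.eventually_analyticAt)
  obtain ⟨s, hs, hs1⟩ := Metric.eventually_nhds_iff_ball.1 h.eventually_nhds
  filter_upwards [Metric.ball_mem_nhds (x : ℂ) (half_pos (lt_min hr hs))] with z hz
  have hz' : ‖z - x‖ < min r s / 2 := by simpa [dist_eq_norm] using hz
  have hre : |z.re - x| < min r s / 2 := by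
    have := Complex.abs_re_le_norm (z - x); simp at this; linarith
  have him : |z.im| < min r s / 2 := by
    have := Complex.abs_im_le_norm (z - x); simp at this; linarith
  have hmr := min_le_left r s
  have hms := min_le_right r s
  have hball : Metric.ball (z.re : ℂ) (r / 2) ⊆ Metric.ball (x : ℂ) r := by
    refine Metric.ball_subset_ball' ?_
    rw [Complex.dist_of_im_eq (by simp), Complex.ofReal_re, Complex.ofReal_re, Real.dist_eq]
    linarith
  have hd : DifferentiableOn ℂ F (Metric.ball (z.re : ℂ) (r / 2)) := fun w hw =>
    (hr1 w (hball hw)).1.differentiableAt.differentiableWithinAt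
  have hzb : z ∈ Metric.ball (z.re : ℂ) (r / 2) := by
    rw [Metric.mem_ball, Complex.dist_of_re_eq (by simp), Complex.ofReal_im, Real.dist_eq, sub_zero]
    linarith
  rw [← Complex.taylorSeries_eq_on_ball' hzb hd, complexify]
  have hsub : z - (z.re : ℂ) = z.im * Complex.I := by
    apply Complex.ext <;> simp
  have hxs : z.re ∈ Metric.ball x s := by
    rw [Metric.mem_ball, Real.dist_eq]; linarith
  rw [hsub]
  refine tsum_congr fun n => ?_
  rw [iteratedDeriv_ofReal n (hr1 _ (hball (Metric.mem_ball_self (half_pos hr)))).1 (hs1 _ hxs)]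

/-! ## The space `𝒜(Ω)` of real analytic functions on an open set -/

/-- The complex-valued real analytic functions on the open set `Ω`. -/
def realAnSubmodule (Ω : TopologicalSpace.Opens ℝ) : Submodule ℂ (Ω → ℂ) where
  carrier := {f | AnalyticOnNhd ℝ (zeroExt f) Ω}
  add_mem' {f g} hf hg := (AnalyticOnNhd.add hf hg).congr Ω.isOpen fun x hx => by
    simp only [Pi.add_apply, zeroExt_apply _ x hx]
  zero_mem' := (analyticOnNhd_const (v := (0 : ℂ))).congr Ω.isOpen fun x hx =>
    (zeroExt_apply (0 : Ω → ℂ) x hx).symm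
  smul_mem' c f hf := (AnalyticOnNhd.congr (f := c • zeroExt f)
    Ω.isOpen (fun x hx => (hf x hx).const_smul) fun x hx => by
      simp only [Pi.smul_apply, zeroExt_apply _ x hx])

/-- The space `𝒜(Ω)` of real analytic functions on the open set `Ω`. -/
def RealAn (Ω : TopologicalSpace.Opens ℝ) : Type := realAnSubmodule Ω

namespace RealAn

instance (Ω : TopologicalSpace.Opens ℝ) : AddCommGroup (RealAn Ω) :=
  inferInstanceAs (AddCommGroup (realAnSubmodule Ω))

instance (Ω : TopologicalSpace.Opens ℝ) : Module ℂ (RealAn Ω) :=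
  inferInstanceAs (Module ℂ (realAnSubmodule Ω))

variable {Ω : TopologicalSpace.Opens ℝ}

theorem analyticAt (f : RealAn Ω) {x : ℝ} (hx : x ∈ Ω) : AnalyticAt ℝ (zeroExt f.1) x :=
  (show AnalyticOnNhd ℝ (zeroExt f.1) Ω from f.2) x hx

theorem analyticOnNhd_complexify (f : RealAn Ω) {K : Set ℝ} (h : K ⊆ Ω) :
    AnalyticOnNhd ℂ (complexify (zeroExt f.1)) (Complex.ofReal '' K) := by
  rintro _ ⟨x, hx, rfl⟩
  exact analyticAt_complexify (f.analyticAt (h hx))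

/-- The identity theorem for germs on a subset of `Ω`. -/
theorem germ_ext {K : Set ℝ} (h : K ⊆ Ω) {F G : ℂ → ℂ}
    {hF : AnalyticOnNhd ℂ F (Complex.ofReal '' K)} {hG : AnalyticOnNhd ℂ G (Complex.ofReal '' K)}
    (hFG : ∀ x ∈ Ω, F (x : ℝ) = G x) : HolGerm.mk F hF = HolGerm.mk G hG := by
  refine HolGerm.mk_eq_mk.2 (eventually_nhdsSet_iff_forall.2 ?_)
  rintro _ ⟨x, hx, rfl⟩
  exact extension_unique (hF _ ⟨x, hx, rfl⟩) (hG _ ⟨x, hx, rfl⟩)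
    (eventually_of_mem (Ω.isOpen.mem_nhds (h hx)) hFG)

/-- The linear map `𝒜(Ω) → ℋ(K)`, `K ⊆ Ω`, that takes `f` to the germ on `K` of its holomorphic
extension. -/
def toGerm (K : Set ℝ) (h : K ⊆ Ω) : RealAn Ω →ₗ[ℂ] HolGerm (Complex.ofReal '' K) where
  toFun f := HolGerm.mk (complexify (zeroExt f.1)) (f.analyticOnNhd_complexify h)
  map_add' f g := by
    refine germ_ext h (G := complexify (zeroExt f.1) + complexify (zeroExt g.1))
      (hG := (f.analyticOnNhd_complexify h).add (g.analyticOnNhd_complexify h)) fun x hx => ?_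
    simp only [Pi.add_apply, complexify_ofReal, zeroExt_apply _ x hx]
    rfl
  map_smul' c f := by
    refine germ_ext h (G := c • complexify (zeroExt f.1))
      (hG := fun z hz => (f.analyticOnNhd_complexify h z hz).const_smul) fun x hx => ?_
    simp only [Pi.smul_apply, complexify_ofReal, zeroExt_apply _ x hx]
    rfl

/-- `𝒜(Ω)` carries the topology of the projective limit of the spaces `ℋ(K)`, `K ⊆ Ω` compact: the
coarsest topology for which all the maps `𝒜(Ω) → ℋ(K)` are continuous. -/
instance : TopologicalSpace (RealAn Ω) :=
  ⨅ K : {K : Set ℝ // IsCompact K ∧ K ⊆ Ω}, TopologicalSpace.induced (toGerm K.1 K.2.2) inferInstance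

instance : IsTopologicalAddGroup (RealAn Ω) :=
  topologicalAddGroup_iInf fun K => topologicalAddGroup_induced (toGerm K.1 K.2.2)

instance : ContinuousSMul ℂ (RealAn Ω) :=
  continuousSMul_iInf fun K => continuousSMul_induced (toGerm K.1 K.2.2)

instance : LocallyConvexSpace ℝ (RealAn Ω) :=
  LocallyConvexSpace.iInf fun K => LocallyConvexSpace.induced ((toGerm K.1 K.2.2).restrictScalars ℝ)

theorem continuous_toGerm (K : Set ℝ) (hK : IsCompact K) (h : K ⊆ Ω) : Continuous (toGerm K h) :=
  continuous_iInf_dom (i := (⟨K, hK, h⟩ : {K : Set ℝ // IsCompact K ∧ K ⊆ Ω})) continuous_induced_dom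

/-- The composition operator `C_φ : 𝒜(Ω) → 𝒜(Ω)`, `f ↦ f ∘ φ`, of a real analytic map
`φ : Ω → Ω`, as a linear map. -/
def compₗ (φ : Ω → Ω) (hφ : AnalyticOnNhd ℝ (zeroExt fun x => (φ x : ℝ)) Ω) :
    RealAn Ω →ₗ[ℂ] RealAn Ω where
  toFun f := ⟨f.1 ∘ φ, by
    refine AnalyticOnNhd.congr Ω.isOpen
      (AnalyticOnNhd.comp (t := Ω) (fun x hx => f.analyticAt hx) hφ fun x hx => ?_) fun x hx => ?_
    · rw [zeroExt_apply _ x hx]; exact (φ ⟨x, hx⟩).2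
    · rw [Function.comp_apply, zeroExt_apply _ x hx, zeroExt_apply _ x hx,
        zeroExt_apply _ _ (φ ⟨x, hx⟩).2]; rfl⟩
  map_add' f g := rfl
  map_smul' c f := rfl

theorem continuous_compₗ (φ : Ω → Ω) (hφ : AnalyticOnNhd ℝ (zeroExt fun x => (φ x : ℝ)) Ω) :
    Continuous (compₗ φ hφ) := by
  refine continuous_iInf_rng.2 fun ⟨K, hK, hKΩ⟩ => continuous_induced_rng.2 ?_
  have hφΩ : ∀ x ∈ Ω, zeroExt (fun x => (φ x : ℝ)) x ∈ Ω := fun x hx => by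
    rw [zeroExt_apply _ x hx]; exact (φ ⟨x, hx⟩).2
  let L : Set ℝ := zeroExt (fun x => (φ x : ℝ)) '' K
  have hL : IsCompact L := hK.image_of_continuousOn (hφ.continuousOn.mono hKΩ)
  have hLΩ : L ⊆ Ω := by
    rintro _ ⟨x, hx, rfl⟩
    exact hφΩ x (hKΩ hx)
  let Φ : ℂ → ℂ := complexify fun x => ((zeroExt (fun x => (φ x : ℝ)) x : ℝ) : ℂ)
  have hΦ : AnalyticOnNhd ℂ Φ (Complex.ofReal '' K) := by
    rintro _ ⟨x, hx, rfl⟩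
    exact analyticAt_complexify
      ((Complex.ofRealCLM.analyticAt _).comp (hφ x (hKΩ hx)))
  have hΦr : ∀ x : ℝ, Φ x = (zeroExt (fun x => (φ x : ℝ)) x : ℝ) := fun x => complexify_ofReal _ x
  have hKL : MapsTo Φ (Complex.ofReal '' K) (Complex.ofReal '' L) := by
    rintro _ ⟨x, hx, rfl⟩
    exact ⟨_, ⟨x, hx, rfl⟩, (hΦr x).symm⟩
  refine ((HolGerm.continuous_comp Φ hΦ hKL).comp (continuous_toGerm L hL hLΩ)).congr fun f => ?_
  change HolGerm.comp Φ hΦ hKL (HolGerm.mk _ (f.analyticOnNhd_complexify hLΩ)) =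
    HolGerm.mk _ ((compₗ φ hφ f).analyticOnNhd_complexify hKΩ)
  rw [HolGerm.comp_mk]
  refine germ_ext hKΩ fun x hx => ?_
  rw [Function.comp_apply, hΦr, complexify_ofReal, complexify_ofReal,
    zeroExt_apply _ _ (hφΩ x hx)]
  refine Eq.trans ?_ (zeroExt_apply (compₗ φ hφ f).1 x hx).symm
  exact congrArg f.1 (Subtype.ext (zeroExt_apply (fun x => (φ x : ℝ)) x hx))

/-- The composition operator `C_φ : 𝒜(Ω) → 𝒜(Ω)`, `f ↦ f ∘ φ`, of a real analytic map
`φ : Ω → Ω`, as a continuous linear map. -/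
def compL (φ : Ω → Ω) (hφ : AnalyticOnNhd ℝ (zeroExt fun x => (φ x : ℝ)) Ω) :
    RealAn Ω →L[ℂ] RealAn Ω :=
  ⟨compₗ φ hφ, continuous_compₗ φ hφ⟩

end RealAn

/-! ## The map `x ↦ x²` on `]0, 1[` -/

/-- The open interval `]0, 1[`. -/
def openUnitInterval : TopologicalSpace.Opens ℝ := ⟨Ioo 0 1, isOpen_Ioo⟩

/-- The map `φ(x) = x²` of `]0, 1[` to itself. -/
def sqMap (x : openUnitInterval) : openUnitInterval :=
  ⟨(x : ℝ) ^ 2, pow_pos x.2.1 2, pow_lt_one₀ x.2.1.le x.2.2 two_ne_zero⟩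

theorem analytic_sqMap :
    AnalyticOnNhd ℝ (zeroExt fun x => (sqMap x : ℝ)) openUnitInterval :=
  AnalyticOnNhd.congr (f := fun x => x ^ 2) openUnitInterval.isOpen
    (fun _ _ => analyticAt_id.pow 2) fun x hx =>
      (zeroExt_apply (fun x => (sqMap x : ℝ)) x hx).symm

end RealAnalyticDynamics

end

noncomputable section

namespace RealAnalyticDynamics

/-! (a) In the coordinate `logLog`, w = log(-log x)/log 2, the interval ]0,1[ becomes the real line
and squaring becomes w ↦ w + 1. The claim is thus a Birkhoff theorem for real analytic functions:
some entire F has integer translates converging to any given g holomorphic near ℝ, locally uniformly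
on one neighbourhood W of ℝ. W may depend on g, but not on the index of the translate; convergence
in 𝒜 then follows because each ℋ(U) → ℋ(K) is continuous.

Entire functions decaying on horizontal strips can be placed far apart and summed, so a dense
sequence of them yields a universal F (`exists_entire_translates_close`, `exists_universal_entire`).
It remains to approximate g by such functions on rectangles whose heights δ M do not depend on the
accuracy. Truncating g to [-A, A] and convolving with a narrow Gaussian gives an entire function
decaying on strips. Moving the contour to the horizontal line through z shows that it approximates g
on every rectangle where g is holomorphic (`norm_heatSmoothing_sub_le`), with the same real data
serving all rectangles at once.

(b) On a fixed disc about 1/2 the iterates of ψ are z ↦ z^(2^n), by the identity theorem, and for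
large n these are not injective there. If ψ^n identifies two points, all but finitely many orbit
elements of C_ψ take equal values at them, a closed condition incompatible with density. -/

/-! ### Universal entire functions for translations -/

/-- The entire functions that tend to zero at infinity on every horizontal strip. -/
def stripDecaying : Set C(ℂ, ℂ) :=
  {f | Differentiable ℂ f ∧ ∀ H ε : ℝ, 0 < ε →
    ∃ R : ℝ, ∀ z : ℂ, |z.im| ≤ H → R ≤ |z.re| → ‖f z‖ ≤ ε}

/-- One radius serves the first j + 1 functions, so that later a new translate can be kept away from
all earlier ones. The rate (1/4)^j leaves room to split it as (1/2)^i * (1/2)^j. -/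
theorem exists_stripDecaying_bound (e : ℕ → stripDecaying) (j : ℕ) :
    ∃ R : ℕ, ∀ l ≤ j, ∀ z : ℂ, |z.im| ≤ j → (R : ℝ) ≤ |z.re| → ‖(e l).1 z‖ ≤ (1 / 4) ^ j := by
  choose R hR using fun l => (e l).2.2 j ((1 / 4) ^ j) (by positivity)
  obtain ⟨B, hB⟩ := exists_nat_ge (∑ l ∈ Finset.range (j + 1), |R l|)
  refine ⟨B, fun l hl z hz hz' => hR l z hz (le_trans ?_ hz')⟩
  refine (le_abs_self _).trans (le_trans ?_ hB)
  exact Finset.single_le_sum (f := fun l => |R l|) (fun _ _ => abs_nonneg _)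
    (Finset.mem_range.2 (Nat.lt_succ_of_le hl))

/-- Given a sequence of entire functions that decay on strips, far apart translates of them can be
summed to an entire function that is close to each of them after a translation. -/
theorem exists_entire_translates_close (e : ℕ → stripDecaying) :
    ∃ F : ℂ → ℂ, Differentiable ℂ F ∧ ∃ n : ℕ → ℕ, (∀ i, i ≤ n i) ∧
      ∀ i : ℕ, ∀ z : ℂ, ‖z‖ ≤ i → ‖F (z + n i) - (e i).1 z‖ ≤ 2 * (1 / 2) ^ i := by
  choose R hR using exists_stripDecaying_bound e
  -- The gap between n j and any earlier n i is at least j + R j: the summand j absorbs the real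
  -- part of a point of the disc, and R j is the decay radius.
  let n : ℕ → ℕ := fun j => ∑ l ∈ Finset.range (j + 1), (l + R l)
  have hn0 : ∀ j, j + R j ≤ n j := fun j =>
    Finset.single_le_sum (f := fun l => l + R l) (fun _ _ => Nat.zero_le _)
      (Finset.mem_range.2 (Nat.lt_succ_self j))
  have hn1 : ∀ i j, i < j → n i + (j + R j) ≤ n j := by
    intro i j hij
    obtain ⟨k, rfl⟩ := Nat.exists_eq_add_of_lt hij
    change _ ≤ ∑ l ∈ Finset.range (i + k + 1 + 1), (l + R l)
    rw [Finset.sum_range_succ]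
    exact Nat.add_le_add_right (Finset.sum_le_sum_of_subset
      (Finset.range_subset_range.2 (by omega))) _
  have hnorm : ∀ (z : ℂ) (k : ℕ), ‖z‖ ≤ k → |z.re| ≤ k ∧ |z.im| ≤ k := fun z k hz =>
    ⟨(Complex.abs_re_le_norm z).trans hz, (Complex.abs_im_le_norm z).trans hz⟩
  -- smallness near the origin
  have hA : ∀ (r j : ℕ) (z : ℂ), r ≤ j → ‖z‖ ≤ r → ‖(e j).1 (z - n j)‖ ≤ (1 / 4) ^ j := by
    intro r j z hrj hz
    obtain ⟨h1, h2⟩ := hnorm z r hz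
    have h3 : (r : ℝ) ≤ j := Nat.cast_le.2 hrj
    have h4 : (j : ℝ) + R j ≤ n j := by exact_mod_cast hn0 j
    refine hR j j le_rfl _ (by simpa using h2.trans h3) ?_
    have h5 : (z - n j).re = z.re - n j := by simp
    rw [h5]
    have := (abs_le.1 h1).2
    refine le_trans ?_ (neg_le_abs _)
    linarith
  -- The larger of the two indices supplies the decay radius: R i bounds every earlier e j, and R j
  -- bounds e j itself when j > i.
  have hB : ∀ (i j : ℕ) (z : ℂ), j ≠ i → ‖z‖ ≤ i →
      ‖(e j).1 (z + n i - n j)‖ ≤ (1 / 2) ^ i * (1 / 2) ^ j := by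
    intro i j z hij hz
    obtain ⟨h1, h2⟩ := hnorm z i hz
    have h5 : (z + n i - n j).re = z.re + n i - n j := by simp
    have h6 : (z + n i - n j).im = z.im := by simp
    have h7 : ∀ k : ℕ, ((1 : ℝ) / 4) ^ k = (1 / 2) ^ k * (1 / 2) ^ k := fun k => by
      rw [← mul_pow]; norm_num
    rcases lt_or_gt_of_ne hij with h | h
    · have h4 : (n j : ℝ) + (i + R i) ≤ n i := by exact_mod_cast hn1 j i h
      refine (hR i j h.le _ (by rw [h6]; exact h2) ?_).trans ?_
      · rw [h5]
        have := (abs_le.1 h1).1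
        refine le_trans ?_ (le_abs_self _)
        linarith
      · rw [h7]
        gcongr ?_ * ?_
        exact pow_le_pow_of_le_one (by norm_num) (by norm_num) h.le
    · have h4 : (n i : ℝ) + (j + R j) ≤ n j := by exact_mod_cast hn1 i j h
      have h3 : (i : ℝ) ≤ j := Nat.cast_le.2 h.le
      refine (hR j j le_rfl _ (by rw [h6]; exact h2.trans h3) ?_).trans ?_
      · rw [h5]
        have := (abs_le.1 h1).2
        refine le_trans ?_ (neg_le_abs _)
        linarith
      · rw [h7]
        gcongr ?_ * ?_
        exact pow_le_pow_of_le_one (by norm_num) (by norm_num) h.le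
  have hgeo : Summable fun j : ℕ => ((1 : ℝ) / 4) ^ j :=
    summable_geometric_of_lt_one (by norm_num) (by norm_num)
  -- locally uniform summability
  have hsum : ∀ r : ℕ, ∃ u : ℕ → ℝ, Summable u ∧
      ∀ j, ∀ z ∈ Metric.ball (0 : ℂ) r, ‖(e j).1 (z - n j)‖ ≤ u j := by
    intro r
    have hc : ∀ j, ∃ C, ∀ z ∈ Metric.closedBall (0 : ℂ) r, ‖(e j).1 (z - n j)‖ ≤ C := fun j =>
      (isCompact_closedBall (0 : ℂ) (r : ℝ)).exists_bound_of_continuousOn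
        ((e j).1.continuous.comp (continuous_id.sub continuous_const)).continuousOn
    choose C hC using hc
    refine ⟨fun j => if j < r then C j else (1 / 4) ^ j, ?_, fun j z hz => ?_⟩
    · rw [← summable_nat_add_iff r]
      refine ((summable_nat_add_iff r).2 hgeo).congr fun j => ?_
      simp
    · beta_reduce
      split_ifs with hj
      · exact hC j z (Metric.ball_subset_closedBall hz)
      · exact hA r j z (not_lt.1 hj) (by simpa using (Metric.mem_ball.1 hz).le)
  have hdiff : ∀ j, Differentiable ℂ fun z : ℂ => (e j).1 (z - n j) := fun j =>
    (e j).2.1.comp (differentiable_id.sub (differentiable_const _))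
  refine ⟨fun z => ∑' j, (e j).1 (z - n j), fun z => ?_, n,
    fun i => (Nat.le_add_right _ _).trans (hn0 i), fun i z hz => ?_⟩
  · obtain ⟨r, hr⟩ := exists_nat_gt ‖z‖
    obtain ⟨u, hu, hu'⟩ := hsum r
    exact (Complex.differentiableOn_tsum_of_summable_norm hu
      (fun j => (hdiff j).differentiableOn) Metric.isOpen_ball hu').differentiableAt
        (Metric.isOpen_ball.mem_nhds (by simpa using hr))
  · have hs : Summable fun j => (e j).1 (z + n i - n j) := by
      obtain ⟨r, hr⟩ := exists_nat_gt ‖z + n i‖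
      obtain ⟨u, hu, hu'⟩ := hsum r
      exact Summable.of_norm_bounded hu fun j => hu' j _ (by simpa using hr)
    beta_reduce
    -- The i-th term is exactly e i at z; the other terms sum to at most (1/2)^i times the geometric
    -- series with sum 2.
    rw [hs.tsum_eq_add_tsum_ite i, add_sub_cancel_right, add_sub_cancel_left]
    have hg2 : HasSum (fun j : ℕ => ((1 : ℝ) / 2) ^ i * (1 / 2) ^ j) ((1 / 2) ^ i * 2) :=
      hasSum_geometric_two.mul_left _
    rw [mul_comm 2]
    refine tsum_of_norm_bounded hg2 fun j => ?_
    split_ifs with hj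
    · rw [norm_zero]; positivity
    · exact hB i j z hj hz

/-- A universal entire function: its integer translates approximate all the entire functions that
decay on strips. -/
theorem exists_universal_entire :
    ∃ F : ℂ → ℂ, Differentiable ℂ F ∧ ∀ G : ℕ → stripDecaying, ∃ n : ℕ → ℕ, StrictMono n ∧
      ∀ k : ℕ, ∀ z : ℂ, ‖z‖ ≤ k → ‖F (z + n k) - (G k).1 z‖ ≤ 1 / (k + 1) := by
  have hne : Nonempty stripDecaying :=
    ⟨⟨0, differentiable_const 0, fun H ε hε => ⟨0, fun z _ _ => by simpa using hε.le⟩⟩⟩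
  obtain ⟨d, hd⟩ := TopologicalSpace.exists_dense_seq stripDecaying
  -- Unpairing repeats each d j at all indices `Nat.pair j t`, hence with arbitrarily small error
  -- and arbitrarily large translation.
  obtain ⟨F, hF, n, hn, hFn⟩ := exists_entire_translates_close fun i => d i.unpair.1
  refine ⟨F, hF, fun G => ?_⟩
  refine extraction_forall_of_frequently
    (P := fun k m => ∀ z : ℂ, ‖z‖ ≤ k → ‖F (z + m) - (G k).1 z‖ ≤ 1 / (k + 1)) fun k => ?_
  rw [frequently_atTop]
  intro m
  have hpos : (0 : ℝ) < 1 / (k + 1) / 2 := by positivity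
  have hnear : ∀ᶠ g : stripDecaying in 𝓝 (G k), ∀ z ∈ Metric.closedBall (0 : ℂ) k,
      dist ((G k).1 z) (g.1 z) < 1 / (k + 1) / 2 := by
    have h1 : Tendsto (fun g : stripDecaying => g.1) (𝓝 (G k)) (𝓝 (G k).1) :=
      continuous_subtype_val.tendsto _
    have h2 := (ContinuousMap.tendsto_iff_forall_isCompact_tendstoUniformlyOn.1 h1)
      (Metric.closedBall 0 k) (isCompact_closedBall _ _)
    exact Metric.tendstoUniformlyOn_iff.1 h2 _ hpos
  obtain ⟨_, hg, j, rfl⟩ := mem_closure_iff_nhds.1 (hd (G k)) _ hnear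
  have hlim : Tendsto (fun i : ℕ => 2 * ((1 : ℝ) / 2) ^ i) atTop (𝓝 0) := by
    simpa using (tendsto_pow_atTop_nhds_zero_of_lt_one (r := (1 : ℝ) / 2) (by norm_num)
      (by norm_num)).const_mul 2
  obtain ⟨t, ht, htk, htm⟩ := (((tendsto_order.1 hlim).2 _ hpos).and
    ((eventually_ge_atTop k).and (eventually_ge_atTop m))).exists
  have hti : t ≤ Nat.pair j t := Nat.right_le_pair j t
  refine ⟨n (Nat.pair j t), (htm.trans hti).trans (hn _), fun z hz => ?_⟩
  have h3 := hFn (Nat.pair j t) z (hz.trans (Nat.cast_le.2 (htk.trans hti)))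
  rw [Nat.unpair_pair] at h3
  have h4 := hg z (by simpa using hz)
  rw [dist_comm, dist_eq_norm] at h4
  have h5 : 2 * ((1 : ℝ) / 2) ^ Nat.pair j t ≤ 2 * (1 / 2) ^ t := by
    gcongr 2 * ?_
    exact pow_le_pow_of_le_one (by norm_num) (by norm_num) hti
  calc ‖F (z + n (Nat.pair j t)) - (G k).1 z‖
      ≤ ‖F (z + n (Nat.pair j t)) - (d j).1 z‖ + ‖(d j).1 z - (G k).1 z‖ :=
        norm_sub_le_norm_sub_add_norm_sub _ _ _
    _ ≤ 1 / (k + 1) := by linarith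

/-! ### Gaussian smoothing -/

/-- The heat kernel on the complex plane, normalized on the real line. -/
def heatKernel (c : ℝ) (z : ℂ) : ℂ := (√(c / Real.pi) : ℝ) * Complex.exp (-c * z ^ 2)

theorem differentiable_heatKernel (c : ℝ) : Differentiable ℂ (heatKernel c) := by
  unfold heatKernel; fun_prop

theorem norm_heatKernel (c : ℝ) (z : ℂ) :
    ‖heatKernel c z‖ = √(c / Real.pi) * Real.exp (-c * (z.re ^ 2 - z.im ^ 2)) := by
  rw [heatKernel, norm_mul, Complex.norm_exp, Complex.norm_real, Real.norm_of_nonneg (by positivity)]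
  congr 2
  simp [pow_two]

theorem heatKernel_ofReal (c s : ℝ) :
    heatKernel c s = ((√(c / Real.pi) * Real.exp (-c * s ^ 2) : ℝ) : ℂ) := by
  rw [heatKernel]; push_cast; rfl

/-- Here re² - im² ≥ 3/4, so the exponential is at most exp(-3c/4) ≤ 4/c², which outweighs the
normalizing factor √(c/π) ≤ c. -/
theorem norm_heatKernel_le {c : ℝ} (hc : 1 ≤ c) {z : ℂ} (hre : 1 ≤ |z.re|) (him : |z.im| ≤ 1 / 2) :
    ‖heatKernel c z‖ ≤ 4 / c := by
  have hc0 : 0 < c := by linarith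
  have h1 : √(c / Real.pi) ≤ c := by
    refine Real.sqrt_le_iff.2 ⟨hc0.le, ?_⟩
    rw [div_le_iff₀ Real.pi_pos]
    nlinarith [Real.pi_gt_three, mul_le_mul hc hc zero_le_one hc0.le]
  have h2 : 1 ≤ z.re ^ 2 := by rw [← sq_abs]; nlinarith
  have h3 : z.im ^ 2 ≤ 1 / 4 := by rw [← sq_abs]; nlinarith [abs_nonneg z.im]
  have h4 : Real.exp (-c * (z.re ^ 2 - z.im ^ 2)) ≤ 4 / c ^ 2 := by
    have h5 : c ^ 2 / 4 ≤ Real.exp (3 / 4 * c) := by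
      have := Real.quadratic_le_exp_of_nonneg (x := 3 / 4 * c) (by positivity)
      nlinarith
    calc Real.exp (-c * (z.re ^ 2 - z.im ^ 2)) ≤ Real.exp (-(3 / 4 * c)) :=
          Real.exp_le_exp.2 (by nlinarith)
      _ = (Real.exp (3 / 4 * c))⁻¹ := Real.exp_neg _
      _ ≤ (c ^ 2 / 4)⁻¹ := inv_anti₀ (by positivity) h5
      _ = 4 / c ^ 2 := inv_div _ _
  rw [norm_heatKernel]
  calc √(c / Real.pi) * Real.exp (-c * (z.re ^ 2 - z.im ^ 2)) ≤ c * (4 / c ^ 2) := by gcongr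
    _ = 4 / c := by field_simp

theorem integral_heatKernel {c : ℝ} (hc : 0 < c) :
    ∫ s : ℝ, √(c / Real.pi) * Real.exp (-c * s ^ 2) = 1 := by
  rw [MeasureTheory.integral_const_mul, integral_gaussian, ← Real.sqrt_mul (by positivity),
    div_mul_div_cancel₀ Real.pi_ne_zero, div_self hc.ne', Real.sqrt_one]

/-- The convolution with the heat kernel is close to the original function, quantitatively. -/
theorem norm_integral_mul_heatKernel_sub_le {c η B x : ℝ} (hc : 0 < c) (hB : 0 ≤ B) {u : ℝ → ℂ}
    (hu : MeasureTheory.Integrable fun t : ℝ => u t * heatKernel c (x - t : ℝ))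
    (h : ∀ t, ‖u t - u x‖ ≤ η + B * (x - t) ^ 2) :
    ‖(∫ t : ℝ, u t * heatKernel c (x - t : ℝ)) - u x‖ ≤ η + 3 * B / c := by
  have hg : ∀ b : ℝ, 0 < b → MeasureTheory.Integrable fun s : ℝ =>
      √(c / Real.pi) * Real.exp (-b * s ^ 2) := fun b hb =>
    (integrable_exp_neg_mul_sq hb).const_mul _
  have hk : MeasureTheory.Integrable fun t : ℝ => heatKernel c (x - t : ℝ) := by
    simp_rw [heatKernel_ofReal]
    exact ((hg c hc).comp_sub_left x).ofReal
  have hk1 : ∫ t : ℝ, heatKernel c (x - t : ℝ) = 1 := by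
    simp_rw [heatKernel_ofReal]
    rw [integral_complex_ofReal, MeasureTheory.integral_sub_left_eq_self
      (fun s => √(c / Real.pi) * Real.exp (-c * s ^ 2)), integral_heatKernel hc, Complex.ofReal_one]
  have h1 : (∫ t : ℝ, u t * heatKernel c (x - t : ℝ)) - u x =
      ∫ t : ℝ, (u t - u x) * heatKernel c (x - t : ℝ) := by
    simp_rw [sub_mul]
    rw [MeasureTheory.integral_sub hu (hk.const_mul _), MeasureTheory.integral_const_mul, hk1,
      mul_one]
  -- Half of the Gaussian is spent on the factor s²: y ≤ exp y with y = cs²/2 gives s² exp(-cs²) ≤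
  -- (2/c) exp(-cs²/2). The remaining Gaussian of parameter c/2 has total mass √2 ≤ 3/2 in this
  -- normalization.
  let m : ℝ → ℝ := fun s => η * (√(c / Real.pi) * Real.exp (-c * s ^ 2)) +
    B * (2 / c) * (√(c / Real.pi) * Real.exp (-(c / 2) * s ^ 2))
  have hm : MeasureTheory.Integrable m :=
    ((hg c hc).const_mul _).add ((hg (c / 2) (by positivity)).const_mul _)
  have hmi : ∫ s, m s = η + B * (2 / c) * √2 := by
    simp only [m]
    rw [MeasureTheory.integral_add ((hg c hc).const_mul _)
      ((hg (c / 2) (by positivity)).const_mul _), MeasureTheory.integral_const_mul,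
      integral_heatKernel hc, MeasureTheory.integral_const_mul, MeasureTheory.integral_const_mul,
      integral_gaussian, ← Real.sqrt_mul (by positivity), mul_one]
    congr 3
    field_simp
  rw [h1]
  refine (MeasureTheory.norm_integral_le_of_norm_le (hm.comp_sub_left x)
    (Eventually.of_forall fun t => ?_)).trans ?_
  · rw [norm_mul, heatKernel_ofReal, Complex.norm_real, Real.norm_of_nonneg (by positivity)]
    have h2 : (x - t) ^ 2 * Real.exp (-c * (x - t) ^ 2) ≤
        2 / c * Real.exp (-(c / 2) * (x - t) ^ 2) := by
      have h3 : -c * (x - t) ^ 2 = -(c / 2 * (x - t) ^ 2) + -(c / 2) * (x - t) ^ 2 := by ring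
      rw [h3, Real.exp_add, ← mul_assoc]
      gcongr
      rw [Real.exp_neg, ← div_eq_mul_inv, div_le_iff₀ (Real.exp_pos _), div_mul_eq_mul_div,
        le_div_iff₀ hc]
      have := Real.add_one_le_exp (c / 2 * (x - t) ^ 2)
      nlinarith
    calc ‖u t - u x‖ * (√(c / Real.pi) * Real.exp (-c * (x - t) ^ 2))
        ≤ (η + B * (x - t) ^ 2) * (√(c / Real.pi) * Real.exp (-c * (x - t) ^ 2)) := by
          gcongr; exact h t
      _ = η * (√(c / Real.pi) * Real.exp (-c * (x - t) ^ 2)) +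
          B * √(c / Real.pi) * ((x - t) ^ 2 * Real.exp (-c * (x - t) ^ 2)) := by ring
      _ ≤ η * (√(c / Real.pi) * Real.exp (-c * (x - t) ^ 2)) +
          B * √(c / Real.pi) * (2 / c * Real.exp (-(c / 2) * (x - t) ^ 2)) := by gcongr
      _ = m (x - t) := by simp only [m]; ring
  · rw [MeasureTheory.integral_sub_left_eq_self m, hmi]
    have h4 : √2 ≤ 3 / 2 := Real.sqrt_le_iff.2 ⟨by norm_num, by norm_num⟩
    have : B * (2 / c) * √2 ≤ B * (2 / c) * (3 / 2) := by gcongr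
    calc η + B * (2 / c) * √2 ≤ η + B * (2 / c) * (3 / 2) := by gcongr
      _ = η + 3 * B / c := by ring

/-- The convolution of the restriction of `h` to `[-A, A]` with the heat kernel. -/
def heatSmoothing (c A : ℝ) (h : ℂ → ℂ) (z : ℂ) : ℂ :=
  ∫ t in (-A)..A, h t * heatKernel c (z - t)

theorem differentiable_heatSmoothing (c : ℝ) {A : ℝ} (hA : 0 ≤ A) {h : ℂ → ℂ}
    (hh : ContinuousOn (fun t : ℝ => h t) (Icc (-A) A)) :
    Differentiable ℂ (heatSmoothing c A h) := by
  intro z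
  have hk' : Continuous (deriv (heatKernel c)) :=
    ((differentiable_heatKernel c).contDiff (n := 1)).continuous_deriv le_rfl
  have hAA : uIcc (-A) A = Icc (-A) A := uIcc_of_le (by linarith)
  have hcont : ∀ (k : ℂ → ℂ), Continuous k → ∀ w : ℂ,
      ContinuousOn (fun t : ℝ => h t * k (w - t)) (uIcc (-A) A) := fun k hk w => by
    rw [hAA]
    exact hh.mul (hk.comp (by fun_prop)).continuousOn
  have hcont2 : ContinuousOn (fun p : ℂ × ℝ => h p.2 * deriv (heatKernel c) (p.1 - p.2))
      (Metric.closedBall z 1 ×ˢ Icc (-A) A) :=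
    (hh.comp continuousOn_snd fun p hp => hp.2).mul (hk'.comp (by fun_prop)).continuousOn
  obtain ⟨C, hC⟩ := ((isCompact_closedBall z 1).prod isCompact_Icc).exists_bound_of_continuousOn
    hcont2
  have hAI : uIoc (-A) A ⊆ Icc (-A) A := by
    rw [uIoc_of_le (by linarith)]; exact Ioc_subset_Icc_self
  have hmeas : ∀ (k : ℂ → ℂ), Continuous k → ∀ w : ℂ, MeasureTheory.AEStronglyMeasurable
      (fun t : ℝ => h t * k (w - t)) (MeasureTheory.volume.restrict (uIoc (-A) A)) :=
    fun k hk w => ((hcont k hk w).mono (hAI.trans hAA.symm.subset)).aestronglyMeasurable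
      measurableSet_uIoc
  have hkc := (differentiable_heatKernel c).continuous
  refine (intervalIntegral.hasDerivAt_integral_of_dominated_loc_of_deriv_le
    (F := fun w t => h t * heatKernel c (w - t))
    (F' := fun w t => h t * deriv (heatKernel c) (w - t)) (bound := fun _ => C)
    (Metric.closedBall_mem_nhds z one_pos) (Eventually.of_forall fun w => hmeas _ hkc w)
    (hcont _ hkc z).intervalIntegrable (hmeas _ hk' z)
    (Eventually.of_forall fun t ht w hw => hC (w, t) ⟨hw, hAI ht⟩)
    intervalIntegrable_const
    (Eventually.of_forall fun t _ w _ => ?_)).2.differentiableAt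
  exact (((differentiable_heatKernel c) (w - t)).hasDerivAt.comp_sub_const w t).const_mul _

/-- The integration runs over a bounded interval. If |Re z| ≥ A + s with s ≥ 1 and |Im z| ≤ H, the
exponential in the kernel is at most exp(cH²) exp(-cs), uniformly in t. -/
theorem heatSmoothing_mem {c A : ℝ} (hc : 0 < c) (hA : 0 ≤ A) {h : ℂ → ℂ}
    (hh : ContinuousOn (fun t : ℝ => h t) (Icc (-A) A)) :
    (⟨heatSmoothing c A h, (differentiable_heatSmoothing c hA hh).continuous⟩ : C(ℂ, ℂ)) ∈
      stripDecaying := by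
  refine ⟨differentiable_heatSmoothing c hA hh, fun H ε hε => ?_⟩
  obtain ⟨C, hC⟩ := isCompact_Icc.exists_bound_of_continuousOn hh
  have hC0 : 0 ≤ C := (norm_nonneg _).trans (hC 0 ⟨by linarith, hA⟩)
  have hlim : Tendsto (fun s : ℝ => C * (√(c / Real.pi) * (Real.exp (c * H ^ 2) *
      Real.exp (-(c * s)))) * (2 * A)) atTop (𝓝 0) := by
    have h1 : Tendsto (fun s : ℝ => Real.exp (-(c * s))) atTop (𝓝 0) :=
      Real.tendsto_exp_neg_atTop_nhds_zero.comp (tendsto_id.const_mul_atTop hc)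
    simpa using (((h1.const_mul (Real.exp (c * H ^ 2))).const_mul (√(c / Real.pi))).const_mul
      C).mul_const (2 * A)
  obtain ⟨s, hs, hs1⟩ := (((tendsto_order.1 hlim).2 _ hε).and (eventually_ge_atTop 1)).exists
  refine ⟨A + s, fun z hz hz' => ?_⟩
  refine le_trans ?_ hs.le
  have hlen : |A - -A| = 2 * A := by rw [abs_of_nonneg] <;> linarith
  rw [← hlen]
  refine intervalIntegral.norm_integral_le_of_norm_le_const fun t ht => ?_
  rw [uIoc_of_le (by linarith)] at ht
  rw [norm_mul, norm_heatKernel]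
  have h2 : s ≤ |z.re - t| := by
    have := abs_sub_abs_le_abs_sub z.re t
    have : |t| ≤ A := abs_le.2 ⟨ht.1.le, ht.2⟩
    linarith
  have h3 : s ≤ (z.re - t) ^ 2 := by rw [← sq_abs]; nlinarith
  have h4 : z.im ^ 2 ≤ H ^ 2 := sq_le_sq' (by linarith [(abs_le.1 hz).1]) (abs_le.1 hz).2
  gcongr
  · exact hC t ⟨ht.1.le, ht.2⟩
  · rw [← Real.exp_add]
    refine Real.exp_le_exp.2 ?_
    simp only [Complex.sub_re, Complex.ofReal_re, Complex.sub_im, Complex.ofReal_im, sub_zero]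
    nlinarith

/-- The heat smoothing of a function that is holomorphic on a rectangle approximates it there. -/
theorem norm_heatSmoothing_sub_le {c a A δ C B η : ℝ} (hc : 1 ≤ c) (ha : 1 ≤ a) (haA : a ≤ A)
    (hδ : δ ≤ 1 / 2) (hC : 0 ≤ C) (hCB : C ≤ B) (hη : 0 ≤ η) {g : ℂ → ℂ}
    (hg : DifferentiableOn ℂ g (Icc (-a) a ×ℂ Icc (-δ) δ))
    (hgC : ∀ w ∈ Icc (-a) a ×ℂ Icc (-δ) δ, ‖g w‖ ≤ C)
    (hgr : ContinuousOn (fun t : ℝ => g t) (Icc (-A) A))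
    (hgrC : ∀ t ∈ Icc (-A) A, ‖g (t : ℝ)‖ ≤ C)
    (hgB : ∀ p ∈ Icc (-a) a ×ℂ Icc (-δ) δ, ∀ q ∈ Icc (-a) a ×ℂ Icc (-δ) δ,
      ‖g p - g q‖ ≤ η + B * ‖p - q‖ ^ 2)
    {z : ℂ} (hre : |z.re| ≤ a - 1) (him : |z.im| ≤ δ) :
    ‖heatSmoothing c A g z - g z‖ ≤ η + ((2 * A + 1) * 4 * C + 3 * B) / c := by
  have hc0 : 0 < c := by linarith
  have hre' := abs_le.1 hre
  have him' := abs_le.1 him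
  have hkc := (differentiable_heatKernel c).continuous
  let f : ℂ → ℂ := fun w => g w * heatKernel c (z - w)
  have hfd : DifferentiableOn ℂ f (Icc (-a) a ×ℂ Icc (-δ) δ) :=
    hg.mul ((differentiable_heatKernel c).comp
      ((differentiable_const z).sub differentiable_id)).differentiableOn
  have hfr : ContinuousOn (fun t : ℝ => f t) (Icc (-A) A) :=
    hgr.mul (hkc.comp (by fun_prop)).continuousOn
  have hii : ∀ p q : ℝ, p ∈ Icc (-A) A → q ∈ Icc (-A) A →
      IntervalIntegrable (fun t : ℝ => f t) MeasureTheory.volume p q := fun p q hp hq =>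
    (hfr.mono (uIcc_subset_Icc hp hq)).intervalIntegrable
  have hmA : -A ∈ Icc (-A) A := ⟨le_rfl, by linarith⟩
  have hma : -a ∈ Icc (-A) A := ⟨by linarith, by linarith⟩
  have hpa : a ∈ Icc (-A) A := ⟨by linarith, by linarith⟩
  have hpA : A ∈ Icc (-A) A := ⟨by linarith, le_rfl⟩
  have hsplit : heatSmoothing c A g z = (∫ t in (-A)..(-a), f t) + (∫ t in (-a)..a, f t) +
      ∫ t in a..A, f t := by
    rw [intervalIntegral.integral_add_adjacent_intervals (hii _ _ hmA hma) (hii _ _ hma hpa),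
      intervalIntegral.integral_add_adjacent_intervals (hii _ _ hmA hpa) (hii _ _ hpa hpA)]
    rfl
  have hker : ∀ w : ℂ, 1 ≤ |z.re - w.re| → |z.im - w.im| ≤ 1 / 2 → ‖g w‖ ≤ C →
      ‖f w‖ ≤ C * (4 / c) := fun w h1 h2 h3 => by
    rw [norm_mul]
    exact mul_le_mul h3 (norm_heatKernel_le hc (by simpa using h1) (by simpa using h2))
      (norm_nonneg _) hC
  have hleft : ‖∫ t in (-A)..(-a), f t‖ ≤ C * (4 / c) * (A - a) := by
    have hlen : |-a - -A| = A - a := by rw [abs_of_nonneg] <;> linarith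
    rw [← hlen]
    refine intervalIntegral.norm_integral_le_of_norm_le_const fun t ht => ?_
    rw [uIoc_of_le (by linarith)] at ht
    refine hker _ ?_ (by simpa using him.trans hδ) (hgrC t ⟨ht.1.le, by linarith [ht.2]⟩)
    rw [Complex.ofReal_re]
    exact le_trans (by linarith [ht.2]) (le_abs_self _)
  have hright : ‖∫ t in a..A, f t‖ ≤ C * (4 / c) * (A - a) := by
    have hlen : |A - a| = A - a := by rw [abs_of_nonneg]; linarith
    rw [← hlen]
    refine intervalIntegral.norm_integral_le_of_norm_le_const fun t ht => ?_
    rw [uIoc_of_le haA] at ht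
    refine hker _ ?_ (by simpa using him.trans hδ) (hgrC t ⟨by linarith [ht.1], ht.2⟩)
    rw [Complex.ofReal_re]
    exact le_trans (by linarith [ht.1]) (neg_le_abs _)
  have huIcc : uIcc 0 z.im ⊆ Icc (-δ) δ :=
    uIcc_subset_Icc ⟨by linarith, by linarith⟩ him'
  -- This is applied to the vertical sides b = ±a, which are at horizontal distance at least 1 from
  -- z and have length at most δ ≤ 1/2.
  have hvert : ∀ b : ℝ, b ∈ Icc (-a) a → 1 ≤ |z.re - b| →
      ‖∫ s in (0 : ℝ)..z.im, f (b + s * Complex.I)‖ ≤ C * (4 / c) * (1 / 2) := by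
    intro b hb hb1
    refine (intervalIntegral.norm_integral_le_of_norm_le_const (C := C * (4 / c)) fun s hs =>
      ?_).trans ?_
    · have hs' : s ∈ uIcc 0 z.im := uIoc_subset_uIcc hs
      refine hker _ (by simpa using hb1) ?_ (hgC _ ⟨by simpa using hb, by simpa using huIcc hs'⟩)
      have := abs_sub_right_of_mem_uIcc hs'
      rw [sub_zero] at this
      simpa using this.trans (him.trans hδ)
    · rw [sub_zero]
      have := him.trans hδ
      gcongr
  -- Cauchy's theorem moves the middle integral to height Im z, where z - w is real and the kernel
  -- is a real probability density.
  have hrect := Complex.integral_boundary_rect_eq_zero_of_differentiableOn f ((-a : ℝ) : ℂ)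
    (a + z.im * Complex.I) (hfd.mono fun w hw => by
      simp only [Complex.mem_reProdIm, Complex.ofReal_re, Complex.ofReal_im, Complex.add_re,
        Complex.add_im, Complex.mul_re, Complex.mul_im, Complex.I_re, Complex.I_im, mul_zero,
        mul_one, sub_zero, add_zero, zero_add] at hw
      rw [uIcc_of_le (by linarith)] at hw
      exact ⟨hw.1, huIcc hw.2⟩)
  simp only [Complex.ofReal_re, Complex.ofReal_im, Complex.add_re,
        Complex.add_im, Complex.mul_re, Complex.mul_im, Complex.I_re, Complex.I_im, mul_zero,
        mul_one, sub_zero, add_zero, zero_add, Complex.ofReal_zero, zero_mul] at hrect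
  -- the shifted integral
  let u : ℝ → ℂ := (Icc (-a) a).indicator fun t => g (t + z.im * Complex.I)
  have hmemS : ∀ t ∈ Icc (-a) a, (t + z.im * Complex.I : ℂ) ∈ Icc (-a) a ×ℂ Icc (-δ) δ :=
    fun t ht => ⟨by simpa using ht, by simpa using him'⟩
  have hzre : z.re ∈ Icc (-a) a := ⟨by linarith, by linarith⟩
  have huz : u z.re = g z := by
    simp only [u]
    rw [indicator_of_mem hzre, Complex.re_add_im]
  have hfu : (fun t : ℝ => u t * heatKernel c (z.re - t : ℝ)) =
      (Icc (-a) a).indicator fun t : ℝ => f (t + z.im * Complex.I) := by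
    funext t
    by_cases ht : t ∈ Icc (-a) a
    · simp only [u, f]
      rw [indicator_of_mem ht, indicator_of_mem ht]
      congr 2
      apply Complex.ext <;> simp
    · simp only [u]
      rw [indicator_of_notMem ht, indicator_of_notMem ht, zero_mul]
  have hfs : ContinuousOn (fun t : ℝ => f (t + z.im * Complex.I)) (Icc (-a) a) :=
    hfd.continuousOn.comp (by fun_prop) hmemS
  have hmid : (∫ t : ℝ, u t * heatKernel c (z.re - t : ℝ)) =
      ∫ t in (-a)..a, f (t + z.im * Complex.I) := by
    rw [hfu, MeasureTheory.integral_indicator measurableSet_Icc,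
      MeasureTheory.integral_Icc_eq_integral_Ioc,
      intervalIntegral.integral_of_le (by linarith)]
  have hmidle := norm_integral_mul_heatKernel_sub_le (c := c) (η := η) (B := B) (x := z.re)
    hc0 (hC.trans hCB) (u := u)
    (by
      rw [hfu, MeasureTheory.integrable_indicator_iff measurableSet_Icc]
      exact hfs.integrableOn_Icc)
    (fun t => by
      by_cases ht : t ∈ Icc (-a) a
      · simp only [u]
        rw [indicator_of_mem ht, indicator_of_mem hzre]
        refine (hgB _ (hmemS t ht) _ (hmemS _ hzre)).trans_eq ?_
        rw [add_sub_add_right_eq_sub, ← Complex.ofReal_sub, Complex.norm_real, Real.norm_eq_abs,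
          sq_abs]
        ring
      · rw [huz]
        simp only [u]
        rw [indicator_of_notMem ht, zero_sub, norm_neg]
        -- Off [-a, a] the truncated function vanishes and the distance is at least 1, so ‖g z‖ ≤ C
        -- ≤ B (z.re - t)²; this is where C ≤ B is needed.
        have h1 : 1 ≤ |z.re - t| := by
          rcases lt_or_ge t (-a) with h | h
          · exact le_trans (by linarith) (le_abs_self _)
          · have : a < t := not_le.1 fun h' => ht ⟨h, h'⟩
            exact le_trans (by linarith) (neg_le_abs _)
        have h2 : 1 ≤ (z.re - t) ^ 2 := by rw [← sq_abs]; nlinarith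
        have h3 : ‖g z‖ ≤ C := hgC z ⟨hzre, him'⟩
        nlinarith [mul_le_mul hCB h2 zero_le_one (hC.trans hCB)])
  rw [hmid, huz] at hmidle
  have hv1 := hvert a ⟨by linarith, le_rfl⟩ (le_trans (by linarith) (neg_le_abs _))
  have hv2 := hvert (-a) ⟨le_rfl, by linarith⟩ (le_trans (by linarith) (le_abs_self _))
  have hdecomp : heatSmoothing c A g z - g z =
      ((∫ t in (-A)..(-a), f t) + ∫ t in a..A, f t) +
      (Complex.I • (∫ s in (0 : ℝ)..z.im, f ((-a : ℝ) + s * Complex.I)) -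
        Complex.I • ∫ s in (0 : ℝ)..z.im, f (a + s * Complex.I)) +
      ((∫ t in (-a)..a, f (t + z.im * Complex.I)) - g z) := by
    rw [hsplit]
    linear_combination hrect
  rw [hdecomp]
  refine (norm_add₃_le).trans ?_
  have hn1 := norm_add_le (∫ t in (-A)..(-a), f t) (∫ t in a..A, f t)
  have hn2 := norm_sub_le (Complex.I • (∫ s in (0 : ℝ)..z.im, f ((-a : ℝ) + s * Complex.I)))
    (Complex.I • ∫ s in (0 : ℝ)..z.im, f (a + s * Complex.I))
  rw [norm_smul, norm_smul, Complex.norm_I, one_mul, one_mul] at hn2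
  have hD : 0 ≤ C * (4 / c) := by positivity
  have hfin : η + ((2 * A + 1) * 4 * C + 3 * B) / c =
      η + 3 * B / c + C * (4 / c) * (2 * A + 1) := by ring
  rw [hfin]
  nlinarith

/-! ### Approximation near the real line -/

theorem exists_rect_analyticAt {g : ℂ → ℂ} (hg : ∀ x : ℝ, AnalyticAt ℂ g x) (a : ℝ) :
    ∃ δ : ℝ, 0 < δ ∧ δ ≤ 1 / 2 ∧ ∀ z ∈ Icc (-a) a ×ℂ Icc (-δ) δ, AnalyticAt ℂ g z := by
  have hK : IsCompact (Complex.ofReal '' Icc (-a) a) :=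
    isCompact_Icc.image Complex.continuous_ofReal
  obtain ⟨δ, hδ, hsub⟩ := hK.exists_cthickening_subset_open (isOpen_analyticAt ℂ g)
    (by rintro _ ⟨x, _, rfl⟩; exact hg x)
  refine ⟨min δ (1 / 2), lt_min hδ (by norm_num), min_le_right _ _, fun z hz => hsub ?_⟩
  refine Metric.mem_cthickening_of_dist_le z (z.re : ℂ) _ _ ⟨z.re, hz.1, rfl⟩ ?_
  rw [Complex.dist_of_re_eq (by simp), Complex.ofReal_im, Real.dist_eq, sub_zero]
  exact (abs_le.2 hz.2).trans (min_le_left _ _)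

/-- A function that is holomorphic near the real line is approximated, uniformly on each of a
sequence of rectangles that cover the real line, by entire functions that decay on strips. -/
theorem exists_stripDecaying_approx {g : ℂ → ℂ} (hg : ∀ x : ℝ, AnalyticAt ℂ g x) :
    ∃ δ : ℕ → ℝ, (∀ M, 0 < δ M) ∧
      ∀ (N : ℕ) (η : ℝ), 0 < η → ∃ G : stripDecaying, ∀ M ≤ N, ∀ z : ℂ, |z.re| ≤ M →
        |z.im| ≤ δ M → ‖G.1 z - g z‖ ≤ η := by
  -- The half-width M + 1 leaves the unit margin around |Re z| ≤ M that the kernel bound requires.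
  -- The heights are fixed before N and η.
  choose δ hδ0 hδ hδg using fun M : ℕ => exists_rect_analyticAt hg (M + 1)
  refine ⟨δ, hδ0, fun N η hη => ?_⟩
  let A : ℝ := N + 1
  have hA : 0 ≤ A := by positivity
  have hgr : ContinuousOn (fun t : ℝ => g t) (Icc (-A) A) := fun t _ =>
    ((hg t).continuousAt.comp Complex.continuous_ofReal.continuousAt).continuousWithinAt
  obtain ⟨C₀, hC₀⟩ := isCompact_Icc.exists_bound_of_continuousOn hgr
  have hev : ∀ M ∈ Finset.range (N + 1), ∀ᶠ c : ℝ in atTop, ∀ z : ℂ, |z.re| ≤ M →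
      |z.im| ≤ δ M → ‖heatSmoothing c A g z - g z‖ ≤ η := by
    intro M hM
    have hMN : (M : ℝ) ≤ N := Nat.cast_le.2 (Nat.lt_succ_iff.1 (Finset.mem_range.1 hM))
    let S : Set ℂ := Icc (-((M : ℝ) + 1)) (M + 1) ×ℂ Icc (-δ M) (δ M)
    have hS : IsCompact S := isCompact_Icc.reProdIm isCompact_Icc
    have hgS : DifferentiableOn ℂ g S := fun w hw =>
      (hδg M w hw).differentiableAt.differentiableWithinAt
    obtain ⟨C₁, hC₁⟩ := hS.exists_bound_of_continuousOn hgS.continuousOn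
    let C : ℝ := max (max C₀ C₁) 0
    have hC0 : 0 ≤ C := le_max_right _ _
    obtain ⟨d, hd, hdg⟩ := Metric.uniformContinuousOn_iff.1
      (hS.uniformContinuousOn_of_continuous hgS.continuousOn) (η / 2) (half_pos hη)
    -- Points closer than d are handled by uniform continuity; for the others ‖g p - g q‖ ≤ 2C ≤
    -- (2C/d²)‖p - q‖². The summand C secures C ≤ B.
    let B : ℝ := C + 2 * C / d ^ 2
    have hCB : C ≤ B := le_add_of_nonneg_right (by positivity)
    have hgC : ∀ w ∈ S, ‖g w‖ ≤ C := fun w hw =>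
      (hC₁ w hw).trans ((le_max_right _ _).trans (le_max_left _ _))
    have hlim : Tendsto (fun c : ℝ => η / 2 + ((2 * A + 1) * 4 * C + 3 * B) / c) atTop
        (𝓝 (η / 2)) := by
      have h1 : Tendsto (fun c : ℝ => ((2 * A + 1) * 4 * C + 3 * B) / c) atTop (𝓝 0) :=
        tendsto_const_nhds.div_atTop tendsto_id
      simpa using h1.const_add (η / 2)
    filter_upwards [eventually_ge_atTop 1, (tendsto_order.1 hlim).2 η (half_lt_self hη)]
      with c hc hcη z hre him
    refine (norm_heatSmoothing_sub_le hc (a := M + 1) (δ := δ M) (C := C) (B := B) (η := η / 2)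
      (by simp) (by simpa [A] using hMN) (hδ M) hC0 hCB (half_pos hη).le hgS hgC hgr
      (fun t ht => (hC₀ t ht).trans ((le_max_left _ _).trans (le_max_left _ _)))
      (fun p hp q hq => ?_) (by simpa using hre) him).trans hcη.le
    have hB0 : 0 ≤ B := hC0.trans hCB
    rcases lt_or_ge (dist p q) d with h | h
    · have := hdg p hp q hq h
      rw [dist_eq_norm] at this
      exact this.le.trans (le_add_of_nonneg_right (by positivity))
    · rw [dist_eq_norm] at h
      have h1 : ‖g p - g q‖ ≤ 2 * C :=
        (norm_sub_le _ _).trans (by linarith [hgC p hp, hgC q hq])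
      have h2 : 2 * C ≤ B * ‖p - q‖ ^ 2 := by
        calc 2 * C = 2 * C / d ^ 2 * d ^ 2 := by field_simp
          _ ≤ B * ‖p - q‖ ^ 2 := by
            gcongr
            exact le_add_of_nonneg_left hC0
      linarith
  -- Each of the finitely many rectangles admits all large c, so one smoothing parameter works for
  -- all of them.
  obtain ⟨c, hc0, hc⟩ := ((eventually_gt_atTop (0 : ℝ)).and
    ((Finset.eventually_all _).2 hev)).exists
  exact ⟨⟨_, heatSmoothing_mem hc0 hA hgr⟩, fun M hM =>
    hc M (Finset.mem_range.2 (Nat.lt_succ_of_le hM))⟩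

/-- A universal entire function: every function that is holomorphic near the real line is,
near the real line, a locally uniform limit of integer translates. -/
theorem exists_universal_translates :
    ∃ F : ℂ → ℂ, Differentiable ℂ F ∧ ∀ g : ℂ → ℂ, (∀ x : ℝ, AnalyticAt ℂ g x) →
      ∃ n : ℕ → ℕ, StrictMono n ∧ ∃ W : Set ℂ, IsOpen W ∧ (∀ x : ℝ, (x : ℂ) ∈ W) ∧
        TendstoLocallyUniformlyOn (fun k z => F (z + n k)) g atTop W := by
  obtain ⟨F, hF, hFu⟩ := exists_universal_entire
  refine ⟨F, hF, fun g hg => ?_⟩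
  obtain ⟨δ, hδ, happ⟩ := exists_stripDecaying_approx hg
  choose G hG using fun N : ℕ => happ N (1 / (N + 1)) (by positivity)
  obtain ⟨n, hn, hnF⟩ := hFu G
  -- The M-th rectangle is controlled by every G k with k ≥ M, so the neighbourhood does not shrink
  -- with k.
  let V : ℕ → Set ℂ := fun M => Ioo (-(M : ℝ)) M ×ℂ Ioo (-δ M) (δ M)
  have hV : ∀ M, IsOpen (V M) := fun M => isOpen_Ioo.reProdIm isOpen_Ioo
  refine ⟨n, hn, ⋃ M, V M, isOpen_iUnion hV, fun x => ?_, ?_⟩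
  · obtain ⟨M, hM⟩ := exists_nat_gt |x|
    refine mem_iUnion.2 ⟨M, ?_, ?_⟩
    · simpa using abs_lt.1 hM
    · simpa using hδ M
  · refine tendstoLocallyUniformlyOn_iUnion hV fun M =>
      TendstoUniformlyOn.tendstoLocallyUniformlyOn ?_
    rw [Metric.tendstoUniformlyOn_iff]
    intro ε hε
    have hlim : Tendsto (fun k : ℕ => 2 * (1 / ((k : ℝ) + 1))) atTop (𝓝 0) := by
      simpa using (tendsto_one_div_add_atTop_nhds_zero_nat (𝕜 := ℝ)).const_mul 2
    obtain ⟨r, hr⟩ := exists_nat_ge ((M : ℝ) + δ M)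
    filter_upwards [(tendsto_order.1 hlim).2 ε hε, eventually_ge_atTop M, eventually_ge_atTop r]
      with k hk hMk hrk z hz
    have hre : |z.re| ≤ M := (abs_lt.2 hz.1).le
    have him : |z.im| ≤ δ M := (abs_lt.2 hz.2).le
    have hzk : ‖z‖ ≤ k := by
      have h1 := Complex.norm_le_abs_re_add_abs_im z
      have h2 : (r : ℝ) ≤ k := Nat.cast_le.2 hrk
      linarith
    have h1 := hnF k z hzk
    have h2 := hG k M hMk z hre him
    rw [dist_comm, dist_eq_norm]
    have h3 := norm_sub_le_norm_sub_add_norm_sub (F (z + n k)) ((G k).1 z) (g z)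
    linarith

/-! ### Non-injective iterates and the failure of hypercyclicity on ℋ(U) -/

theorem holComp_pow_apply {U : TopologicalSpace.Opens ℂ} (ψ : U → U)
    (hψ : DifferentiableOn ℂ (zeroExt fun z => (ψ z : ℂ)) U) (n : ℕ) (f : Hol U) (z : U) :
    ((holComp ψ hψ ^ n) f).1 z = f.1 (ψ^[n] z) := by
  induction n generalizing z with
  | zero => rfl
  | succ n ih =>
    rw [pow_succ', Function.iterate_succ_apply]
    exact ih (ψ z)

theorem differentiableOn_zeroExt_iterate {U : TopologicalSpace.Opens ℂ} (ψ : U → U)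
    (hψ : DifferentiableOn ℂ (zeroExt fun z => (ψ z : ℂ)) U) (n : ℕ) :
    DifferentiableOn ℂ (zeroExt fun z => (ψ^[n] z : ℂ)) U := by
  induction n with
  | zero => exact differentiableOn_id.congr fun z hz => zeroExt_apply _ z hz
  | succ n ih =>
    refine (ih.comp hψ fun z hz => ?_).congr fun z hz => ?_
    · rw [zeroExt_apply _ z hz]; exact (ψ ⟨z, hz⟩).2
    · rw [Function.comp_apply, zeroExt_apply _ z hz, zeroExt_apply _ z hz,
        zeroExt_apply _ _ (ψ ⟨z, hz⟩).2, Function.iterate_succ_apply]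

/-- The identity function as an element of `ℋ(U)`. -/
def holId (U : TopologicalSpace.Opens ℂ) : Hol U :=
  ⟨⟨Subtype.val, continuous_subtype_val⟩,
    differentiableOn_id.congr fun z hz => zeroExt_apply _ z hz⟩

/-- If some iterate of `ψ` is not injective, then `C_ψ` is not hypercyclic on `ℋ(U)`. -/
theorem not_hypercyclic_of_iterate_eq {U : TopologicalSpace.Opens ℂ} (ψ : U → U)
    (hψ : DifferentiableOn ℂ (zeroExt fun z => (ψ z : ℂ)) U) {p q : U} (hpq : p ≠ q) {n : ℕ}
    (h : ψ^[n] p = ψ^[n] q) : ¬ Hypercyclic (X := Hol U) (holComp ψ hψ) := by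
  rintro ⟨f, hf⟩
  have hE : IsClosed {g : Hol U | g.1 p = g.1 q} := isClosed_eq
    ((continuous_eval_const p).comp continuous_subtype_val)
    ((continuous_eval_const q).comp continuous_subtype_val)
  have hfin : ((fun m => (holComp ψ hψ ^ m) f) '' Iio n).Finite := (finite_Iio n).image _
  have hC := hE.union hfin.isClosed
  have hsub : (range fun m : ℕ => (holComp ψ hψ ^ m) f) ⊆
      {g : Hol U | g.1 p = g.1 q} ∪ (fun m => (holComp ψ hψ ^ m) f) '' Iio n := by
    rintro _ ⟨m, rfl⟩
    rcases lt_or_ge m n with hm | hm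
    · exact Or.inr ⟨m, hm, rfl⟩
    · left
      change ((holComp ψ hψ ^ m) f).1 p = ((holComp ψ hψ ^ m) f).1 q
      obtain ⟨k, rfl⟩ := Nat.exists_eq_add_of_le' hm
      rw [holComp_pow_apply, holComp_pow_apply, Function.iterate_add_apply,
        Function.iterate_add_apply, h]
  have hpq' : (p : ℂ) ≠ q := fun h => hpq (Subtype.ext h)
  have hval : ∀ (k : ℕ) (z : U), (((k : ℂ) + 1) • holId U).1 z = ((k : ℂ) + 1) * z :=
    fun _ _ => rfl
  -- The orbit lies in a closed set: the functions with equal values at p and q, together with n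
  -- exceptions. Nonzero multiples of the identity separate p and q, so density would place
  -- infinitely many functions among the exceptions.
  have hmem : ∀ k : ℕ, ((k : ℂ) + 1) • holId U ∈
      (fun m => (holComp ψ hψ ^ m) f) '' Iio n := by
    intro k
    rcases closure_minimal hsub hC (hf (((k : ℂ) + 1) • holId U)) with h1 | h1
    · have h1 : (((k : ℂ) + 1) • holId U).1 p = (((k : ℂ) + 1) • holId U).1 q := h1
      rw [hval, hval] at h1
      exact absurd (mul_left_cancel₀ (Nat.cast_add_one_ne_zero k) h1) hpq'
    · exact h1
  refine Set.infinite_of_injective_forall_mem (fun k l hkl => ?_) hmem hfin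
  have hz : ∃ z : U, (z : ℂ) ≠ 0 := by
    by_contra! h0
    exact hpq' ((h0 p).trans (h0 q).symm)
  obtain ⟨z, hz⟩ := hz
  have h2 := congrArg (fun g : Hol U => g.1 z) hkl
  simp only [hval] at h2
  exact_mod_cast add_right_cancel (mul_right_cancel₀ hz h2)

/-- Any neighbourhood of 1/2 contains 1/2 times a nontrivial 2^(n+1)-th root of unity once n is
large, and z ↦ z^(2^(n+1)) identifies the two points. -/
theorem exists_iterate_eq_of_eq_sq {U : TopologicalSpace.Opens ℂ}
    (hU : ∀ x ∈ Ioo (0 : ℝ) 1, (x : ℂ) ∈ U) (ψ : U → U)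
    (hψ : DifferentiableOn ℂ (zeroExt fun z => (ψ z : ℂ)) U)
    (h : ∀ (x : ℝ) (hx : x ∈ Ioo (0 : ℝ) 1), (ψ ⟨(x : ℂ), hU x hx⟩ : ℂ) = (x : ℂ) ^ 2) :
    ∃ (p q : U) (n : ℕ), p ≠ q ∧ ψ^[n] p = ψ^[n] q := by
  have hit : ∀ (n : ℕ) (x : ℝ) (hx : x ∈ Ioo (0 : ℝ) 1),
      (ψ^[n] ⟨(x : ℂ), hU x hx⟩ : ℂ) = (x : ℂ) ^ 2 ^ n := by
    intro n
    induction n with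
    | zero => simp
    | succ n ih =>
      intro x hx
      have hx2 : x ^ 2 ∈ Ioo (0 : ℝ) 1 := ⟨pow_pos hx.1 2, pow_lt_one₀ hx.1.le hx.2 two_ne_zero⟩
      have he : ψ ⟨(x : ℂ), hU x hx⟩ = ⟨((x ^ 2 : ℝ) : ℂ), hU _ hx2⟩ :=
        Subtype.ext (by rw [h x hx]; push_cast; rfl)
      rw [Function.iterate_succ_apply, he, ih _ hx2]
      push_cast
      rw [← pow_mul, pow_succ']
  have h12 : (1 / 2 : ℝ) ∈ Ioo (0 : ℝ) 1 := by norm_num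
  obtain ⟨r, hr, hrU⟩ := Metric.isOpen_iff.1 U.isOpen _ (hU _ h12)
  -- Since ψ maps U to itself, all iterates are holomorphic on the same ball, even if they leave it;
  -- the identity theorem applies with r independent of n.
  have hball : ∀ (n : ℕ) (z : ℂ) (hz : z ∈ Metric.ball ((1 / 2 : ℝ) : ℂ) r),
      (ψ^[n] ⟨z, hrU hz⟩ : ℂ) = z ^ 2 ^ n := by
    intro n z hz
    have hd := differentiableOn_zeroExt_iterate ψ hψ n
    have ha : AnalyticOnNhd ℂ (zeroExt fun z => (ψ^[n] z : ℂ)) (Metric.ball ((1 / 2 : ℝ) : ℂ) r) :=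
      (hd.analyticOnNhd U.isOpen).mono hrU
    have hb : AnalyticOnNhd ℂ (fun z : ℂ => z ^ 2 ^ n) (Metric.ball ((1 / 2 : ℝ) : ℂ) r) :=
      fun z _ => analyticAt_id.pow _
    have heq := ha.eqOn_of_preconnected_of_eventuallyEq hb
      (convex_ball _ _).isPreconnected (Metric.mem_ball_self hr)
      (extension_unique (ha _ (Metric.mem_ball_self hr)) (hb _ (Metric.mem_ball_self hr)) ?_) hz
    · rw [zeroExt_apply _ z (hrU hz)] at heq
      exact heq
    · filter_upwards [isOpen_Ioo.mem_nhds h12] with x hx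
      rw [zeroExt_apply _ _ (hU x hx), hit n x hx]
  -- The 2^n-th power of w n is the negative of that of 1/2, which shows w n ≠ 1/2; one more
  -- squaring makes the powers agree.
  let w : ℕ → ℂ := fun n => ((1 / 2 : ℝ) : ℂ) * Complex.exp ((Real.pi / 2 ^ n : ℝ) * Complex.I)
  have hw : Tendsto w atTop (𝓝 ((1 / 2 : ℝ) : ℂ)) := by
    have h1 : Tendsto (fun n : ℕ => (Real.pi / 2 ^ n : ℝ)) atTop (𝓝 0) :=
      tendsto_const_nhds.div_atTop (tendsto_pow_atTop_atTop_of_one_lt one_lt_two)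
    have h2 : Continuous fun t : ℝ => ((1 / 2 : ℝ) : ℂ) * Complex.exp (t * Complex.I) := by
      fun_prop
    have := (h2.tendsto 0).comp h1
    simpa [w, Function.comp_def] using this
  obtain ⟨n, hn⟩ := (hw.eventually (Metric.ball_mem_nhds _ hr)).exists
  have hb' : ((1 / 2 : ℝ) : ℂ) ∈ Metric.ball ((1 / 2 : ℝ) : ℂ) r := Metric.mem_ball_self hr
  have hpow : w n ^ 2 ^ n = -((1 / 2 : ℝ) : ℂ) ^ 2 ^ n := by
    simp only [w]
    rw [mul_pow, ← Complex.exp_nat_mul]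
    have : ((2 ^ n : ℕ) : ℂ) * ((Real.pi / 2 ^ n : ℝ) * Complex.I) = Real.pi * Complex.I := by
      push_cast
      field_simp
    rw [this, Complex.exp_pi_mul_I, mul_neg_one]
  have hw2 : w n ^ 2 ^ (n + 1) = ((1 / 2 : ℝ) : ℂ) ^ 2 ^ (n + 1) := by
    rw [pow_succ 2 n, pow_mul, pow_mul, hpow, neg_sq]
  refine ⟨⟨w n, hrU hn⟩, ⟨_, hrU hb'⟩, n + 1, fun he => ?_, Subtype.ext ?_⟩
  · have he : w n = ((1 / 2 : ℝ) : ℂ) := congrArg Subtype.val he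
    rw [he] at hpow
    exact absurd (self_eq_neg.1 hpow) (pow_ne_zero _ (by norm_num))
  · rw [hball _ _ hn, hball _ _ hb', hw2]

/-! ### From locally uniform convergence to convergence in 𝒜(Ω) -/

/-- A function that is holomorphic on `U`, as an element of `ℋ(U)`. -/
def Hol.mk {U : TopologicalSpace.Opens ℂ} (F : ℂ → ℂ) (hF : DifferentiableOn ℂ F U) : Hol U :=
  ⟨⟨fun z => F z, hF.continuousOn.comp_continuous continuous_subtype_val fun z => z.2⟩,
    hF.congr fun z hz => zeroExt_apply _ z hz⟩

theorem Hol.tendsto_mk {ι : Type*} {l : Filter ι} {U : TopologicalSpace.Opens ℂ}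
    {F : ι → ℂ → ℂ} (hF : ∀ k, DifferentiableOn ℂ (F k) U) {G : ℂ → ℂ}
    (hG : DifferentiableOn ℂ G U) (h : TendstoLocallyUniformlyOn F G l U) :
    Tendsto (fun k => Hol.mk (F k) (hF k)) l (𝓝 (Hol.mk G hG)) := by
  rw [tendsto_subtype_rng]
  have : LocallyCompactSpace U := U.isOpen.locallyCompactSpace
  rw [ContinuousMap.tendsto_iff_tendstoLocallyUniformly]
  exact tendstoLocallyUniformlyOn_iff_tendstoLocallyUniformly_comp_coe.1 h

/-- Locally uniform convergence on a complex neighbourhood of `Ω` implies convergence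
in `𝒜(Ω)`. -/
theorem RealAn.tendsto_of_tendstoLocallyUniformlyOn {ι : Type*} {l : Filter ι}
    {Ω : TopologicalSpace.Opens ℝ} {U : TopologicalSpace.Opens ℂ}
    (hU : ∀ x ∈ Ω, ((x : ℝ) : ℂ) ∈ U) {f : ι → RealAn Ω} {g : RealAn Ω} {F : ι → ℂ → ℂ}
    {G : ℂ → ℂ} (hF : ∀ k, DifferentiableOn ℂ (F k) U) (hG : DifferentiableOn ℂ G U)
    (hf : ∀ k, ∀ x : Ω, F k ((x : ℝ) : ℂ) = (f k).1 x) (hg : ∀ x : Ω, G ((x : ℝ) : ℂ) = g.1 x)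
    (h : TendstoLocallyUniformlyOn F G l U) : Tendsto f l (𝓝 g) := by
  rw [nhds_iInf, tendsto_iInf]
  rintro ⟨K, hK, hKΩ⟩
  rw [nhds_induced, tendsto_comap_iff]
  have hKU : Complex.ofReal '' K ⊆ U := by
    rintro _ ⟨x, hx, rfl⟩
    exact hU x (hKΩ hx)
  -- By the identity theorem any holomorphic extension gives the same germ as `complexify`, so the
  -- map to ℋ(K) factors through ℋ(U) along the whole family.
  have key : ∀ (H : ℂ → ℂ) (hH : DifferentiableOn ℂ H U) (p : RealAn Ω),
      (∀ x : Ω, H ((x : ℝ) : ℂ) = p.1 x) →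
        HolGerm.ofHol _ U hKU (Hol.mk H hH) = RealAn.toGerm K hKΩ p := by
    intro H hH p hp
    refine RealAn.germ_ext hKΩ
      (hF := (DifferentiableOn.analyticOnNhd (Hol.mk H hH).2 U.isOpen).mono hKU)
      (hG := p.analyticOnNhd_complexify hKΩ) fun x hx => ?_
    rw [complexify_ofReal, zeroExt_apply _ x hx, zeroExt_apply _ _ (hU x hx), ← hp]
    rfl
  have h1 := (((HolGerm.isAdmissible (Complex.ofReal '' K)).4 U hKU).tendsto _).comp
    (Hol.tendsto_mk hF hG h)
  rw [key G hG g hg] at h1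
  exact h1.congr fun k => key (F k) (hF k) (f k) (hf k)

/-! ### Conjugation of squaring to a translation -/

/-- The coordinate on `]0, 1[` in which `x ↦ x²` is the translation by one. -/
def logLog (z : ℂ) : ℂ := Complex.log (-Complex.log z) / Real.log 2

theorem logLog_ofReal {x : ℝ} (hx : x ∈ Ioo (0 : ℝ) 1) :
    logLog x = (Real.log (-Real.log x) / Real.log 2 : ℝ) := by
  have := Real.log_neg hx.1 hx.2
  rw [logLog, ← Complex.ofReal_log hx.1.le, ← Complex.ofReal_neg,
    ← Complex.ofReal_log (by linarith)]
  push_cast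
  rfl

theorem analyticAt_logLog {x : ℝ} (hx : x ∈ Ioo (0 : ℝ) 1) : AnalyticAt ℂ logLog x := by
  have hlog := Real.log_neg hx.1 hx.2
  have h1 : AnalyticAt ℂ Complex.log x :=
    analyticAt_clog (Complex.ofReal_mem_slitPlane.2 hx.1)
  refine AnalyticAt.div_const (h1.neg.clog ?_)
  rw [Pi.neg_apply, ← Complex.ofReal_log hx.1.le, ← Complex.ofReal_neg]
  exact Complex.ofReal_mem_slitPlane.2 (by linarith)

theorem logLog_sq {x : ℝ} (hx : x ∈ Ioo (0 : ℝ) 1) :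
    logLog ((x ^ 2 : ℝ) : ℂ) = logLog x + 1 := by
  have hx2 : x ^ 2 ∈ Ioo (0 : ℝ) 1 := ⟨pow_pos hx.1 2, pow_lt_one₀ hx.1.le hx.2 two_ne_zero⟩
  have hlog := Real.log_neg hx.1 hx.2
  have h2 : Real.log 2 ≠ 0 := (Real.log_pos one_lt_two).ne'
  rw [logLog_ofReal hx, logLog_ofReal hx2, Real.log_pow]
  have h3 : -(((2 : ℕ) : ℝ) * Real.log x) = 2 * -Real.log x := by push_cast; ring
  rw [h3, Real.log_mul two_ne_zero (by linarith), add_div, div_self h2]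
  push_cast
  ring

/-- The inverse of `logLog`. -/
def expExp (w : ℂ) : ℂ := Complex.exp (-Complex.exp (Real.log 2 * w))

theorem differentiable_expExp : Differentiable ℂ expExp := by
  unfold expExp; fun_prop

theorem expExp_ofReal (t : ℝ) : ∃ x ∈ Ioo (0 : ℝ) 1, expExp t = x := by
  refine ⟨Real.exp (-Real.exp (Real.log 2 * t)), ⟨Real.exp_pos _, ?_⟩, ?_⟩
  · rw [Real.exp_lt_one_iff]
    linarith [Real.exp_pos (Real.log 2 * t)]
  · rw [expExp]; push_cast; rfl

theorem expExp_logLog {x : ℝ} (hx : x ∈ Ioo (0 : ℝ) 1) : expExp (logLog x) = x := by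
  have hlog := Real.log_neg hx.1 hx.2
  have h2 : (Real.log 2 : ℂ) ≠ 0 := Complex.ofReal_ne_zero.2 (Real.log_pos one_lt_two).ne'
  rw [expExp, logLog, mul_div_cancel₀ _ h2, Complex.exp_log, neg_neg, Complex.exp_log]
  · exact Complex.ofReal_ne_zero.2 hx.1.ne'
  · rw [← Complex.ofReal_log hx.1.le, ← Complex.ofReal_neg]
    exact Complex.ofReal_ne_zero.2 (by linarith)

/-- The real analytic function on `]0, 1[` that is given by an entire function in the
coordinate `logLog`. -/
def pullback (F : ℂ → ℂ) (hF : Differentiable ℂ F) : RealAn openUnitInterval :=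
  ⟨fun x => F (logLog ((x : ℝ) : ℂ)), by
    have h : AnalyticOnNhd ℝ (fun x : ℝ => F (logLog x)) openUnitInterval := fun x hx =>
      ((hF.analyticAt _).comp (analyticAt_logLog hx)).restrictScalars.comp
        (Complex.ofRealCLM.analyticAt x)
    exact h.congr openUnitInterval.isOpen fun x hx =>
      (zeroExt_apply (fun x : openUnitInterval => F (logLog ((x : ℝ) : ℂ))) x hx).symm⟩

theorem compL_pow_pullback (F : ℂ → ℂ) (hF : Differentiable ℂ F) (n : ℕ)
    (x : openUnitInterval) :
    ((RealAn.compL sqMap analytic_sqMap ^ n) (pullback F hF)).1 x =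
      F (logLog ((x : ℝ) : ℂ) + n) := by
  induction n generalizing x with
  | zero => exact congrArg F (by simp)
  | succ n ih =>
    rw [pow_succ']
    refine (ih (sqMap x)).trans ?_
    change F (logLog ((((x : ℝ) ^ 2 : ℝ)) : ℂ) + n) = _
    rw [logLog_sq x.2]
    push_cast
    congr 1
    ring

/-- The orbit of `pullback F hF` consists of integer translates of F read in the coordinate
`logLog`. A target y becomes its extension composed with `expExp`, which is holomorphic near ℝ, so
the universality of F applies. -/
theorem sequentiallyHypercyclic_sqMap :
    SequentiallyHypercyclic (RealAn.compL sqMap analytic_sqMap) := by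
  obtain ⟨F, hF, hFu⟩ := exists_universal_translates
  refine ⟨pullback F hF, fun y => ?_⟩
  let g : ℂ → ℂ := complexify (zeroExt y.1) ∘ expExp
  have hg : ∀ t : ℝ, AnalyticAt ℂ g t := fun t => by
    obtain ⟨x, hx, hxt⟩ := expExp_ofReal t
    refine AnalyticAt.comp ?_ (differentiable_expExp.analyticAt _)
    rw [hxt]
    exact analyticAt_complexify (y.analyticAt hx)
  obtain ⟨n, hn, W, hW, hWr, hlim⟩ := hFu g hg
  refine ⟨n, hn, ?_⟩
  -- A priori g is analytic only near the real line; on all of W it is holomorphic as a locally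
  -- uniform limit of entire functions.
  have hgW : DifferentiableOn ℂ g W := hlim.differentiableOn
    (Eventually.of_forall fun k =>
      (hF.comp (differentiable_id.add (differentiable_const _))).differentiableOn) hW
  let U : TopologicalSpace.Opens ℂ :=
    ⟨interior ({z | AnalyticAt ℂ logLog z} ∩ logLog ⁻¹' W), isOpen_interior⟩
  have hUW : ∀ z ∈ (U : Set ℂ), AnalyticAt ℂ logLog z ∧ logLog z ∈ W := fun z hz =>
    interior_subset (s := {z | AnalyticAt ℂ logLog z} ∩ logLog ⁻¹' W) hz
  have hUd : DifferentiableOn ℂ logLog U := fun z hz =>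
    (hUW z hz).1.differentiableAt.differentiableWithinAt
  have hUm : MapsTo logLog U W := fun z hz => (hUW z hz).2
  refine RealAn.tendsto_of_tendstoLocallyUniformlyOn (U := U)
    (F := fun k => (fun z => F (z + n k)) ∘ logLog) (G := g ∘ logLog) (fun x hx => ?_)
    (fun k => (hF.comp (differentiable_id.add (differentiable_const _))).comp_differentiableOn hUd)
    (hgW.comp hUd hUm) (fun k x => (compL_pow_pullback F hF (n k) x).symm) (fun x => ?_)
    (hlim.comp logLog hUm hUd.continuousOn)
  · have hlx := analyticAt_logLog hx
    refine mem_interior_iff_mem_nhds.2 (inter_mem hlx.eventually_analyticAt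
      (hlx.continuousAt (hW.mem_nhds ?_)))
    rw [logLog_ofReal hx]
    exact hWr _
  · simp only [g, Function.comp_apply]
    rw [expExp_logLog x.2, complexify_ofReal, zeroExt_apply _ _ x.2]

end RealAnalyticDynamics

end

/-- The operator `C_φ`, `φ(x) = x²`, is sequentially hypercyclic on `𝒜(]0, 1[)`; and for no open
set `U ⊆ ℂ` containing `]0, 1[` and no holomorphic extension `ψ : U → U` of `φ` is the operator
`C_ψ : ℋ(U) → ℋ(U)` hypercyclic. -/
theorem mainTheorem3 :
    RealAnalyticDynamics.SequentiallyHypercyclic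
      (RealAnalyticDynamics.RealAn.compL RealAnalyticDynamics.sqMap
        RealAnalyticDynamics.analytic_sqMap) ∧
    ∀ (U : TopologicalSpace.Opens ℂ) (hU : ∀ x ∈ Set.Ioo (0 : ℝ) 1, (x : ℂ) ∈ U) (ψ : U → U)
      (hψ : DifferentiableOn ℂ (RealAnalyticDynamics.zeroExt fun z => (ψ z : ℂ)) U),
      (∀ (x : ℝ) (hx : x ∈ Set.Ioo (0 : ℝ) 1), (ψ ⟨(x : ℂ), hU x hx⟩ : ℂ) = (x : ℂ) ^ 2) →
      ¬ RealAnalyticDynamics.Hypercyclic (X := RealAnalyticDynamics.Hol U)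
        (RealAnalyticDynamics.holComp ψ hψ) := by
  refine ⟨RealAnalyticDynamics.sequentiallyHypercyclic_sqMap, fun U hU ψ hψ h => ?_⟩
  obtain ⟨p, q, n, hpq, hn⟩ := RealAnalyticDynamics.exists_iterate_eq_of_eq_sq hU ψ hψ h
  exact RealAnalyticDynamics.not_hypercyclic_of_iterate_eq ψ hψ hpq hn
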